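/- Let $q^{1/2}\in\mathbb C^\times$ with $q$ not a root of unity, let $[2]=(q^{-1}-q)/(q^{-1/2}+q^{1/2})$, and let $r\in\mathbb C$. **Setting.** Let $\mathcal U=U_q[osp(1|2)]$ be the superalgebra with even generators $K^{\pm1}$, odd generators $v_\pm$ and relations $KK^{-1}=K^{-1}K=1$, $Kv_\pm=q^{\pm1/2}v_\pm K$, $\{v_+,v_-\}=-(K^2-K^{-2})/(q^4-q^{-4})$, with coproduct $\Delta(K)=K\otimes K$, $\Delta(v_\pm)=v_\pm\otimes K^{-1}+K\otimes v_\pm$ and counit $\epsilon(K)=1$, $\epsilon(v_\pm)=0$. Let $V$ be its three-dimensional representation ($\ell=1$, $\lambda=0$) with basis $z_1,z_0,z_{-1}$, where $z_{\pm1}$ are even and $z_0$ is odd: $Kz_m=q^{m/2}z_m$, $v_-z_1=z_0$, $v_-z_0=-z_{-1}$, $v_-z_{-1}=0$, $v_+z_1=0$, $v_+z_0=-\kappa z_1$, $v_+z_{-1}=-\kappa z_0$, with $\kappa=(q-q^{-1})/(q^4-q^{-4})$; write $Xz_m=\sum_{m'}z_{m'}D_{m'm}(X)$. Let $\mathcal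 A=OSp_q(1|2)$ be the superalgebra of functionals on $\mathcal U$ (with the graded product dual to $\Delta$) generated by the matrix entries $T_{m'm}$, of parity $m'+m$, given by $\langle X,T_{m'm}\rangle=(-1)^{|X|(1-m')}D_{m'm}(X)$. It coacts by $\varphi(z_m)=\sum_{m'}z_{m'}\otimes T_{m'm}$, extended multiplicatively to the free superalgebra on $z_1,z_0,z_{-1}$, with values in the graded tensor product with $\mathcal A$. Put $$E^0=q^{1/2}z_{-1}z_1+z_0^2-q^{-1/2}z_1z_{-1},\qquad E^1_1=-q^{1/2}z_0z_1+q^{-1/2}z_1z_0,$$ $$E^1_0=z_{-1}z_1+(q^{-1/2}+q^{1/2})z_0^2-z_1z_{-1},\qquad E^1_{-1}=q^{1/2}z_{-1}z_0-q^{-1/2}z_0z_{-1}.$$ **Statement.** 1. In $V\otimes V$ the vectors $w$ with $Xw=\epsilon(X)w$ for all $X\in\mathcal U$ are exactly the scalar multiples of the vector corresponding to $E^0$, and the triples $(w_1,w_0,w_{-1})$ with $Xw_M=\sum_{M'}D_{M'M}(X)w_{M'}$ for all $X$ and $M$ are exactly the scalar multiples of the triple corresponding to $(E^1_1,E^1_0,E^1_{-1})$.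 Moreover $\varphi(E^0)=E^0\otimes1$ and $\varphi(E^1_M)=\sum_{M'}E^1_{M'}\otimes(-1)^{M'+M}T_{M'M}$. 2. Let $\Lambda$ be a supercommutative complex superalgebra and let $\xi\in\Lambda$ be odd. Consider the superalgebra over $\Lambda$ generated by $z_{\pm1}$ (even) and $z_0$ (odd), which supercommute with $\Lambda$, subject to the $L=0$ relation $E^0=r$ and the $L=1$ relations $E^1_M=\xi z_M$ $(M=1,0,-1)$. Call the relations consistent if (a) $E^0$, to be equated to the constant $r$, commutes with $z_1,z_0,z_{-1}$ in the superalgebra defined by the $L=1$ relations alone, and (b) any two ways of bringing a product of three generators into the order $z_{-1}^a z_0^{\varepsilon}z_1^b$ $(\varepsilon\in\{0,1\})$, by means of the reordering rules that follow from the relations, give the same result. Then the relations are consistent if and only if $\xi=0$. Also, (b) alone holds if and only if $\xi=0$, and the ordered monomials $z_{-1}^az_0^\varepsilon z_1^b$ form a basis over $\Lambda$ of the superalgebra defined by all the relations if and only if $\xi=0$. 3. For elements $z_1,z_0,z_{-1}$ of any complex algebra, the relations $E^0=r$, $E^1_1=E^1_0=E^1_{-1}=0$ are equivalent to $$z_1z_0=q\,z_0z_1,\qquad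 z_0z_{-1}=q\,z_{-1}z_0,\qquad z_1z_{-1}=q^2z_{-1}z_1-q(q^{-1/2}+q^{1/2})\,r,\qquad z_0^2=-q^{-1}[2]\,z_1z_{-1}-q^{-1}r.$$ 4. The superalgebra $P$ over $\mathbb C$ generated by $z_1,z_0,z_{-1}$ with these last relations is covariant: there is an algebra homomorphism from $P$ to the graded tensor product of $P$ and $\mathcal A$ with $z_m\mapsto\sum_{m'}z_{m'}\otimes T_{m'm}$. -/

import Mathlib

open scoped TensorProduct

noncomputable section

namespace OSpq

/-! ### Superalgebras over the complex numbers -/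

/-- A complex superalgebra: an algebra with its parity automorphism, which is `+1` on the even part
and `-1` on the odd part. -/
class SuperAlgebra (A : Type*) [Ring A] [Algebra ℂ A] where
  parity : A →ₐ[ℂ] A
  parity_parity : ∀ a, parity (parity a) = a

open SuperAlgebra

section Super

variable (A : Type*) [Ring A] [Algebra ℂ A] [SuperAlgebra A]

/-- The homogeneous part of degree `i`. -/
def part (i : ZMod 2) : Submodule ℂ A where
  carrier := {a | parity a = (-1 : ℂ) ^ i.val • a}
  add_mem' {a b} ha hb := by
    simp only [Set.mem_ofPred_eq] at *
    rw [map_add, ha, hb, smul_add]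
  zero_mem' := by simp
  smul_mem' c a ha := by
    simp only [Set.mem_ofPred_eq] at *
    rw [map_smul, ha, smul_comm]

variable {A}

theorem mem_part {i : ZMod 2} {a : A} : a ∈ part A i ↔ parity a = (-1 : ℂ) ^ i.val • a := Iff.rfl

theorem mem_part_zero {a : A} : a ∈ part A 0 ↔ parity a = a := by simp [mem_part]

theorem mem_part_one {a : A} : a ∈ part A 1 ↔ parity a = -a := by
  simp [mem_part, ZMod.val_one]

theorem neg_one_pow_val_add (i j : ZMod 2) :
    (-1 : ℂ) ^ (i + j).val = (-1) ^ i.val * (-1) ^ j.val := by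
  rw [ZMod.val_add, ← pow_add, neg_one_pow_eq_pow_mod_two (i.val + j.val)]

instance : SetLike.GradedMonoid (part A) where
  one_mem := by simp [mem_part]
  mul_mem i j a b ha hb := by
    rw [mem_part] at *
    rw [map_mul, ha, hb, neg_one_pow_val_add, smul_mul_smul_comm]

/-- The decomposition of an element into its even and its odd part. -/
def decomp (a : A) : DirectSum (ZMod 2) fun i => part A i :=
  DirectSum.of (fun i => part A i) 0 ⟨(1 / 2 : ℂ) • (a + parity a), by
      rw [mem_part_zero, map_smul, map_add, parity_parity, add_comm]⟩ +
    DirectSum.of (fun i => part A i) 1 ⟨(1 / 2 : ℂ) • (a - parity a), by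
      rw [mem_part_one, map_smul, map_sub, parity_parity, ← smul_neg, neg_sub]⟩

instance : GradedAlgebra (part A) where
  decompose' := decomp
  left_inv a := by
    simp only [decomp, map_add, DirectSum.coeAddMonoidHom_of]
    rw [← smul_add]
    have : a + parity a + (a - parity a) = (2 : ℂ) • a := by rw [two_smul]; abel
    rw [this, smul_smul]; norm_num
  right_inv x := by
    induction x using DirectSum.induction_on with
    | zero =>
      simp only [map_zero, decomp]
      rw [show (⟨(1 / 2 : ℂ) • ((0 : A) + 0), _⟩ : part A 0) = 0 from by ext; simp,
        show (⟨(1 / 2 : ℂ) • ((0 : A) - 0), _⟩ : part A 1) = 0 from by ext; simp]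
      simp
    | of i x =>
      obtain ⟨x, hx⟩ := x
      rw [DirectSum.coeAddMonoidHom_of]
      fin_cases i
      · have h : parity x = x := mem_part_zero.1 hx
        simp only [decomp]
        rw [show (⟨(1 / 2 : ℂ) • (x + parity x), _⟩ : part A 0) = ⟨x, hx⟩ from by
            ext; simp only [h]; rw [← two_smul ℂ x, smul_smul]; norm_num,
          show (⟨(1 / 2 : ℂ) • (x - parity x), _⟩ : part A 1) = 0 from by
            ext; simp [h], map_zero, add_zero]
        rfl
      · have h : parity x = -x := mem_part_one.1 hx
        simp only [decomp]
        rw [show (⟨(1 / 2 : ℂ) • (x - parity x), _⟩ : part A 1) = ⟨x, hx⟩ from by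
            ext; simp only [h, sub_neg_eq_add]; rw [← two_smul ℂ x, smul_smul]; norm_num,
          show (⟨(1 / 2 : ℂ) • (x + parity x), _⟩ : part A 0) = 0 from by
            ext; simp [h], map_zero, zero_add]
        rfl
    | add x y hx hy =>
      have key : ∀ a b : A, decomp (a + b) = decomp a + decomp b := by
        intro a b
        simp only [decomp]
        rw [add_add_add_comm, ← map_add, ← map_add]
        congr 2
        · ext; simp only [map_add, Submodule.coe_add]; rw [← smul_add]; congr 1; abel
        · ext; simp only [map_add, Submodule.coe_add]; rw [← smul_add]; congr 1; abel
      rw [map_add, key, hx, hy]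

end Super

end OSpq

namespace OSpq

open SuperAlgebra

section Quotients

variable {X : Type*} (s : X → ℕ)

/-- The parity automorphism of the free algebra whose generator `x` has parity `s x`. -/
def freeParity : FreeAlgebra ℂ X →ₐ[ℂ] FreeAlgebra ℂ X :=
  FreeAlgebra.lift ℂ fun x => (-1 : ℂ) ^ s x • FreeAlgebra.ι ℂ x

@[simp] theorem freeParity_ι (x : X) :
    freeParity s (FreeAlgebra.ι ℂ x) = (-1 : ℂ) ^ s x • FreeAlgebra.ι ℂ x := by
  simp [freeParity]

theorem freeParity_freeParity (a : FreeAlgebra ℂ X) : freeParity s (freeParity s a) = a := by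
  have : (freeParity s).comp (freeParity s) = AlgHom.id ℂ _ := by
    ext x
    simp [smul_smul, ← mul_pow]
  exact DFunLike.congr_fun this a

/-- The parity automorphism of a quotient of a free superalgebra by relations that are stable under
parity. -/
def quotientParity (rel : FreeAlgebra ℂ X → FreeAlgebra ℂ X → Prop)
    (h : ∀ ⦃a b⦄, rel a b → RingQuot.mkAlgHom ℂ rel (freeParity s a) =
      RingQuot.mkAlgHom ℂ rel (freeParity s b)) : RingQuot rel →ₐ[ℂ] RingQuot rel :=
  RingQuot.liftAlgHom ℂ ⟨(RingQuot.mkAlgHom ℂ rel).comp (freeParity s), fun _ _ hab => h hab⟩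

theorem quotientParity_mk (rel : FreeAlgebra ℂ X → FreeAlgebra ℂ X → Prop) (h)
    (a : FreeAlgebra ℂ X) : quotientParity s rel h (RingQuot.mkAlgHom ℂ rel a) =
      RingQuot.mkAlgHom ℂ rel (freeParity s a) := by
  exact RingQuot.liftAlgHom_mkAlgHom_apply ℂ ((RingQuot.mkAlgHom ℂ rel).comp (freeParity s))
    (fun _ _ hab => h hab) a

/-- A quotient of a free superalgebra by relations that are stable under parity is again a
superalgebra. -/
@[reducible] def quotientSuper (rel : FreeAlgebra ℂ X → FreeAlgebra ℂ X → Prop)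
    (h : ∀ ⦃a b⦄, rel a b → RingQuot.mkAlgHom ℂ rel (freeParity s a) =
      RingQuot.mkAlgHom ℂ rel (freeParity s b)) : SuperAlgebra (RingQuot rel) where
  parity := quotientParity s rel h
  parity_parity a := by
    obtain ⟨a, rfl⟩ := RingQuot.mkAlgHom_surjective ℂ rel a
    rw [quotientParity_mk, quotientParity_mk, freeParity_freeParity]

end Quotients

/-! ### The index set of the coordinates

`SignType` is the set of weights `{-1, 0, 1}` of the three dimensional representation. -/

/-- The parity of the basis vector of weight `m` (with an even highest weight vector). -/
def par : SignType → ℕ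
  | 0 => 1
  | _ => 0

/-! ### The quantum superalgebra `U_q[osp(1|2)]`; the parameter is `p = q^{1/2}` -/

inductive UGen
  | K
  | Kinv
  | vp
  | vm

def UGen.par : UGen → ℕ
  | .K => 0
  | .Kinv => 0
  | .vp => 1
  | .vm => 1

open FreeAlgebra in
inductive URel (p : ℂˣ) : FreeAlgebra ℂ UGen → FreeAlgebra ℂ UGen → Prop
  | K_Kinv : URel p (ι ℂ .K * ι ℂ .Kinv) 1
  | Kinv_K : URel p (ι ℂ .Kinv * ι ℂ .K) 1
  | K_vp : URel p (ι ℂ .K * ι ℂ .vp) ((p : ℂ) • (ι ℂ .vp * ι ℂ .K))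
  | K_vm : URel p (ι ℂ .K * ι ℂ .vm) ((p : ℂ)⁻¹ • (ι ℂ .vm * ι ℂ .K))
  | vp_vm : URel p (ι ℂ .vp * ι ℂ .vm + ι ℂ .vm * ι ℂ .vp)
      (-(((p : ℂ) ^ 8 - ((p : ℂ) ^ 8)⁻¹)⁻¹ • (ι ℂ .K ^ 2 - ι ℂ .Kinv ^ 2)))

/-- The algebra `U_q[osp(1|2)]`. -/
abbrev U (p : ℂˣ) : Type := RingQuot (URel p)

namespace U

variable (p : ℂˣ)

def gen (g : UGen) : U p := RingQuot.mkAlgHom ℂ (URel p) (FreeAlgebra.ι ℂ g)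

instance : SuperAlgebra (U p) := quotientSuper UGen.par (URel p) <| by
  intro a b h
  have h' := RingQuot.mkAlgHom_rel ℂ h
  cases h <;> simp [UGen.par] at h' ⊢
  all_goals exact h'

variable {p}

theorem K_Kinv : gen p .K * gen p .Kinv = 1 := by
  simpa [gen] using RingQuot.mkAlgHom_rel ℂ (URel.K_Kinv (p := p))

theorem Kinv_K : gen p .Kinv * gen p .K = 1 := by
  simpa [gen] using RingQuot.mkAlgHom_rel ℂ (URel.Kinv_K (p := p))

theorem K_vp : gen p .K * gen p .vp = (p : ℂ) • (gen p .vp * gen p .K) := by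
  simpa [gen] using RingQuot.mkAlgHom_rel ℂ (URel.K_vp (p := p))

theorem K_vm : gen p .K * gen p .vm = (p : ℂ)⁻¹ • (gen p .vm * gen p .K) := by
  simpa [gen] using RingQuot.mkAlgHom_rel ℂ (URel.K_vm (p := p))

theorem vp_vm : gen p .vp * gen p .vm + gen p .vm * gen p .vp =
    -(((p : ℂ) ^ 8 - ((p : ℂ) ^ 8)⁻¹)⁻¹ • (gen p .K ^ 2 - gen p .Kinv ^ 2)) := by
  simpa [gen] using RingQuot.mkAlgHom_rel ℂ (URel.vp_vm (p := p))

/-- The universal property of `U_q[osp(1|2)]`. -/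
def lift {B : Type*} [Ring B] [Algebra ℂ B] (f : UGen → B)
    (h1 : f .K * f .Kinv = 1) (h2 : f .Kinv * f .K = 1)
    (h3 : f .K * f .vp = (p : ℂ) • (f .vp * f .K))
    (h4 : f .K * f .vm = (p : ℂ)⁻¹ • (f .vm * f .K))
    (h5 : f .vp * f .vm + f .vm * f .vp =
      -(((p : ℂ) ^ 8 - ((p : ℂ) ^ 8)⁻¹)⁻¹ • (f .K ^ 2 - f .Kinv ^ 2))) : U p →ₐ[ℂ] B :=
  RingQuot.liftAlgHom ℂ ⟨FreeAlgebra.lift ℂ f, by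
    intro a b h
    cases h <;> simp [h1, h2, h3, h4]
    simpa using h5⟩

@[simp] theorem lift_gen {B : Type*} [Ring B] [Algebra ℂ B] (f : UGen → B) (h1 h2 h3 h4 h5)
    (g : UGen) : lift (p := p) f h1 h2 h3 h4 h5 (gen p g) = f g := by
  simp [lift, gen]

theorem hom_ext {B : Type*} [Ring B] [Algebra ℂ B] {f g : U p →ₐ[ℂ] B}
    (h : ∀ x, f (gen p x) = g (gen p x)) : f = g := by
  apply RingQuot.ringQuot_ext'
  ext x
  exact h x

@[elab_as_elim]
theorem induction {P : U p → Prop} (gen : ∀ g, P (gen p g)) (scalar : ∀ c, P (algebraMap ℂ _ c))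
    (add : ∀ x y, P x → P y → P (x + y)) (mul : ∀ x y, P x → P y → P (x * y)) (X : U p) : P X := by
  obtain ⟨a, rfl⟩ := RingQuot.mkAlgHom_surjective ℂ (URel p) X
  induction a using FreeAlgebra.induction with
  | grade0 c => rw [AlgHom.commutes]; exact scalar c
  | grade1 g => exact gen g
  | mul x y hx hy => rw [map_mul]; exact mul _ _ hx hy
  | add x y hx hy => rw [map_add]; exact add _ _ hx hy

theorem parity_gen (g : UGen) : parity (gen p g) = (-1 : ℂ) ^ g.par • gen p g := by
  rw [gen]
  exact (quotientParity_mk UGen.par (URel p) _ _).trans (by rw [freeParity_ι, map_smul])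

end U

section Tensor

variable {A B : Type*} [Ring A] [Algebra ℂ A] [SuperAlgebra A] [Ring B] [Algebra ℂ B]
  [SuperAlgebra B]

open GradedTensorProduct

theorem tmul_mul_tmul_even_left (a a' : A) (b b' : B) (hb : parity b = b) :
    (a ᵍ⊗ₜ[ℂ] b * a' ᵍ⊗ₜ[ℂ] b' : part A ᵍ⊗[ℂ] part B) = (a * a') ᵍ⊗ₜ[ℂ] (b * b') := by
  have key : ∀ (i : ZMod 2) (x : part A i),
      (a ᵍ⊗ₜ[ℂ] b * (x : A) ᵍ⊗ₜ[ℂ] b' : part A ᵍ⊗[ℂ] part B) = (a * x) ᵍ⊗ₜ[ℂ] (b * b') :=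
    fun i x => tmul_zero_coe_mul_coe_tmul (part A) (part B) a ⟨b, mem_part_zero.2 hb⟩ x b'
  induction a' using DirectSum.Decomposition.inductionOn (part A) with
  | zero => simp [tmul]
  | homogeneous x => exact key _ x
  | add x y hx hy =>
    simp only [tmul, TensorProduct.add_tmul, map_add, mul_add] at *
    rw [hx, hy]

theorem tmul_mul_tmul_even_right (a a' : A) (b b' : B) (ha : parity a' = a') :
    (a ᵍ⊗ₜ[ℂ] b * a' ᵍ⊗ₜ[ℂ] b' : part A ᵍ⊗[ℂ] part B) = (a * a') ᵍ⊗ₜ[ℂ] (b * b') := by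
  have key : ∀ (i : ZMod 2) (x : part B i),
      (a ᵍ⊗ₜ[ℂ] (x : B) * a' ᵍ⊗ₜ[ℂ] b' : part A ᵍ⊗[ℂ] part B) = (a * a') ᵍ⊗ₜ[ℂ] (x * b') :=
    fun i x => tmul_coe_mul_zero_coe_tmul (part A) (part B) a x ⟨a', mem_part_zero.2 ha⟩ b'
  induction b using DirectSum.Decomposition.inductionOn (part B) with
  | zero => simp [tmul]
  | homogeneous x => exact key _ x
  | add x y hx hy =>
    simp only [tmul, TensorProduct.tmul_add, map_add, add_mul] at *
    rw [hx, hy]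

theorem tmul_mul_tmul_odd (a a' : A) (b b' : B) (ha : parity a' = -a') (hb : parity b = -b) :
    (a ᵍ⊗ₜ[ℂ] b * a' ᵍ⊗ₜ[ℂ] b' : part A ᵍ⊗[ℂ] part B) = -((a * a') ᵍ⊗ₜ[ℂ] (b * b')) := by
  have := tmul_coe_mul_coe_tmul (part A) (part B) a ⟨b, mem_part_one.2 hb⟩
    ⟨a', mem_part_one.2 ha⟩ b'
  rw [this]
  have h : (-1 : ℤˣ) ^ ((1 : ZMod 2) * 1) = -1 := by decide
  rw [h]
  simp

/-- The tensor product of the parity automorphisms. -/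
def parityTensor : (part A ᵍ⊗[ℂ] part B) →ₐ[ℂ] (part A ᵍ⊗[ℂ] part B) :=
  GradedTensorProduct.lift (part A) (part B) ((includeLeft (part A) (part B)).comp parity)
    ((includeRight (part A) (part B)).comp parity) (by
      rintro i j ⟨a, ha⟩ ⟨b, hb⟩
      have h := tmul_coe_mul_coe_tmul (part A) (part B) 1 ⟨b, hb⟩ ⟨a, ha⟩ 1
      simp only [one_mul, mul_one] at h
      simp only [AlgHom.comp_apply, includeLeft_apply, includeRight_apply]
      rw [mem_part.1 ha, mem_part.1 hb]
      simp only [tmul, ← TensorProduct.smul_tmul', TensorProduct.tmul_smul, map_smul] at h ⊢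
      rw [smul_mul_smul_comm, smul_mul_smul_comm, h, smul_comm, mul_comm ((-1 : ℂ) ^ j.val)]
      congr 1
      have := tmul_one_mul_one_tmul (part A) (part B) a b
      simp only [tmul] at this
      rw [this, smul_smul, Int.units_mul_self, one_smul])

theorem parityTensor_tmul (a : A) (b : B) :
    parityTensor (a ᵍ⊗ₜ[ℂ] b : part A ᵍ⊗[ℂ] part B) = parity a ᵍ⊗ₜ[ℂ] parity b := by
  rw [parityTensor, lift_tmul]
  exact tmul_one_mul_one_tmul (part A) (part B) (parity a) (parity b)

end Tensor

end OSpq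

namespace OSpq

open SuperAlgebra

theorem sum_sign {M : Type*} [AddCommMonoid M] (f : SignType → M) :
    ∑ i, f i = f 1 + f 0 + f (-1) := by
  have : (Finset.univ : Finset SignType) = {1, 0, -1} := by decide
  rw [this, Finset.sum_insert (by decide), Finset.sum_insert (by decide), Finset.sum_singleton,
    add_assoc]

section Structure

variable (p : ℂˣ)

open U GradedTensorProduct

/-- The coproduct: `Δ(K) = K ⊗ K` and `Δ(v) = v ⊗ K⁻¹ + K ⊗ v` for `v = v₊, v₋`. -/
def coprodGen : UGen → part (U p) ᵍ⊗[ℂ] part (U p)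
  | .K => gen p .K ᵍ⊗ₜ[ℂ] gen p .K
  | .Kinv => gen p .Kinv ᵍ⊗ₜ[ℂ] gen p .Kinv
  | .vp => gen p .vp ᵍ⊗ₜ[ℂ] gen p .Kinv + gen p .K ᵍ⊗ₜ[ℂ] gen p .vp
  | .vm => gen p .vm ᵍ⊗ₜ[ℂ] gen p .Kinv + gen p .K ᵍ⊗ₜ[ℂ] gen p .vm

variable {p}

theorem parity_K : parity (gen p .K) = gen p .K := by simp [parity_gen, UGen.par]
theorem parity_Kinv : parity (gen p .Kinv) = gen p .Kinv := by simp [parity_gen, UGen.par]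
theorem parity_vp : parity (gen p .vp) = -gen p .vp := by
  rw [parity_gen, UGen.par, pow_one]; exact neg_one_smul ℂ (gen p _)
theorem parity_vm : parity (gen p .vm) = -gen p .vm := by
  rw [parity_gen, UGen.par, pow_one]; exact neg_one_smul ℂ (gen p _)

theorem Kinv_vp : gen p .vp * gen p .Kinv = (p : ℂ) • (gen p .Kinv * gen p .vp) := by
  calc gen p .vp * gen p .Kinv = gen p .Kinv * (gen p .K * gen p .vp) * gen p .Kinv := by
        rw [← mul_assoc (gen p .Kinv), Kinv_K, one_mul]
    _ = _ := by
        rw [K_vp, mul_smul_comm, smul_mul_assoc, ← mul_assoc, mul_assoc _ (gen p .K), K_Kinv,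
          mul_one]

theorem Kinv_vm : gen p .vm * gen p .Kinv = (p : ℂ)⁻¹ • (gen p .Kinv * gen p .vm) := by
  calc gen p .vm * gen p .Kinv = gen p .Kinv * (gen p .K * gen p .vm) * gen p .Kinv := by
        rw [← mul_assoc (gen p .Kinv), Kinv_K, one_mul]
    _ = _ := by
        rw [K_vm, mul_smul_comm, smul_mul_assoc, ← mul_assoc, mul_assoc _ (gen p .K), K_Kinv,
          mul_one]

theorem coprod_aux (v : UGen) (c : ℂ) (h : gen p .K * gen p v = c • (gen p v * gen p .K)) :
    (gen p .K ᵍ⊗ₜ[ℂ] gen p .K : part (U p) ᵍ⊗[ℂ] part (U p)) *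
      (gen p v ᵍ⊗ₜ[ℂ] gen p .Kinv + gen p .K ᵍ⊗ₜ[ℂ] gen p v) =
    c • ((gen p v ᵍ⊗ₜ[ℂ] gen p .Kinv + gen p .K ᵍ⊗ₜ[ℂ] gen p v) *
      (gen p .K ᵍ⊗ₜ[ℂ] gen p .K)) := by
  rw [mul_add, add_mul, smul_add, tmul_mul_tmul_even_left _ _ _ _ parity_K,
    tmul_mul_tmul_even_left _ _ _ _ parity_K, tmul_mul_tmul_even_right _ _ _ _ parity_K,
    tmul_mul_tmul_even_right _ _ _ _ parity_K, h, K_Kinv, Kinv_K]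
  simp only [tmul, ← TensorProduct.smul_tmul', TensorProduct.tmul_smul, map_smul]

theorem coprod_vp_vm : coprodGen p .vp * coprodGen p .vm + coprodGen p .vm * coprodGen p .vp =
    -(((p : ℂ) ^ 8 - ((p : ℂ) ^ 8)⁻¹)⁻¹ • (coprodGen p .K ^ 2 - coprodGen p .Kinv ^ 2)) := by
  have hp : (p : ℂ) ≠ 0 := p.ne_zero
  simp only [coprodGen, pow_two]
  simp only [mul_add, add_mul]
  rw [tmul_mul_tmul_even_left _ _ _ _ parity_Kinv, tmul_mul_tmul_even_left _ _ _ _ parity_Kinv,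
    tmul_mul_tmul_even_left _ _ _ _ parity_Kinv, tmul_mul_tmul_even_left _ _ _ _ parity_Kinv,
    tmul_mul_tmul_even_left _ _ _ _ parity_Kinv, tmul_mul_tmul_even_left _ _ _ _ parity_K,
    tmul_mul_tmul_even_right _ _ _ _ parity_K, tmul_mul_tmul_even_right _ _ _ _ parity_K,
    tmul_mul_tmul_odd _ _ _ _ parity_vm parity_vp, tmul_mul_tmul_odd _ _ _ _ parity_vp parity_vm,
    K_vp, K_vm, Kinv_vp, Kinv_vm]
  have e1 : ∀ x y : U p, ((p : ℂ) • x) ᵍ⊗ₜ[ℂ] ((p : ℂ)⁻¹ • y) =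
      (x ᵍ⊗ₜ[ℂ] y : part (U p) ᵍ⊗[ℂ] part (U p)) := by
    intro x y
    simp only [tmul, ← TensorProduct.smul_tmul', TensorProduct.tmul_smul, map_smul, smul_smul]
    rw [inv_mul_cancel₀ hp, one_smul]
  have e2 : ∀ x y : U p, ((p : ℂ)⁻¹ • x) ᵍ⊗ₜ[ℂ] ((p : ℂ) • y) =
      (x ᵍ⊗ₜ[ℂ] y : part (U p) ᵍ⊗[ℂ] part (U p)) := by
    intro x y
    simp only [tmul, ← TensorProduct.smul_tmul', TensorProduct.tmul_smul, map_smul, smul_smul]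
    rw [mul_inv_cancel₀ hp, one_smul]
  rw [e1, e2]
  have h := vp_vm (p := p)
  generalize ((p : ℂ) ^ 8 - ((p : ℂ) ^ 8)⁻¹)⁻¹ = k at h ⊢
  have h1 : gen p .vp * gen p .vm =
      -(k • (gen p .K ^ 2 - gen p .Kinv ^ 2)) - gen p .vm * gen p .vp := by
    rw [← h]; abel
  rw [h1]
  simp only [tmul, TensorProduct.sub_tmul, TensorProduct.tmul_sub, TensorProduct.neg_tmul,
    TensorProduct.tmul_neg, ← TensorProduct.smul_tmul', TensorProduct.tmul_smul, map_sub, map_neg,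
    map_smul, pow_two]
  module

variable (p)

/-- The coproduct of `U_q[osp(1|2)]`. -/
def coprod : U p →ₐ[ℂ] part (U p) ᵍ⊗[ℂ] part (U p) :=
  U.lift (coprodGen p)
    (by
      simp only [coprodGen]
      rw [tmul_mul_tmul_even_left _ _ _ _ parity_K, K_Kinv]; rfl)
    (by
      simp only [coprodGen]
      rw [tmul_mul_tmul_even_left _ _ _ _ parity_Kinv, Kinv_K]; rfl)
    (coprod_aux .vp _ K_vp)
    (coprod_aux .vm _ K_vm)
    coprod_vp_vm

/-- The counit of `U_q[osp(1|2)]`. -/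
def counit : U p →ₐ[ℂ] ℂ :=
  U.lift (fun | .K => 1 | .Kinv => 1 | .vp => 0 | .vm => 0) (by simp) (by simp) (by simp)
    (by simp) (by simp)

/-- The generators in the representation with `ℓ = 1`, `λ = 0`:
`K e_m = q^{m/2} e_m`, `v₋ e_1 = e_0`, `v₋ e_0 = -e_{-1}`,
`v₊ e_0 = -κ e_1`, `v₊ e_{-1} = -κ e_0` with `κ = (q - q⁻¹) / (q⁴ - q⁻⁴)`.
The `(m', m)` entry is the coefficient of `e_{m'}` in the image of `e_m`. -/
def repGen : UGen → Matrix SignType SignType ℂ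
  | .K => Matrix.diagonal fun m => (p : ℂ) ^ (m : ℤ)
  | .Kinv => Matrix.diagonal fun m => (p : ℂ) ^ (-(m : ℤ))
  | .vm => Matrix.of fun i j =>
      match i, j with
      | .zero, .pos => 1
      | .neg, .zero => -1
      | _, _ => 0
  | .vp => Matrix.of fun i j =>
      match i, j with
      | .pos, .zero => -(((p : ℂ) ^ 2 - ((p : ℂ) ^ 2)⁻¹) / ((p : ℂ) ^ 8 - ((p : ℂ) ^ 8)⁻¹))
      | .zero, .neg => -(((p : ℂ) ^ 2 - ((p : ℂ) ^ 2)⁻¹) / ((p : ℂ) ^ 8 - ((p : ℂ) ^ 8)⁻¹))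
      | _, _ => 0

/-- The representation `D` of `U_q[osp(1|2)]` with `ℓ = 1`, `λ = 0`. -/
def rep : U p →ₐ[ℂ] Matrix SignType SignType ℂ :=
  U.lift (repGen p)
    (by
      have hp : (p : ℂ) ≠ 0 := p.ne_zero
      ext i j; cases i <;> cases j <;> simp [repGen, hp])
    (by
      have hp : (p : ℂ) ≠ 0 := p.ne_zero
      ext i j; cases i <;> cases j <;> simp [repGen, hp])
    (by
      have hp : (p : ℂ) ≠ 0 := p.ne_zero
      ext i j; cases i <;> cases j <;> simp [repGen, hp, mul_comm])
    (by
      have hp : (p : ℂ) ≠ 0 := p.ne_zero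
      ext i j; cases i <;> cases j <;> simp [repGen, hp, mul_comm])
    (by
      have hp : (p : ℂ) ≠ 0 := p.ne_zero
      ext i j
      cases i <;> cases j <;>
        simp [repGen, Matrix.mul_apply, sum_sign, pow_two, Matrix.diagonal, div_eq_mul_inv] <;>
        ring)

theorem coprod_gen (g : UGen) : coprod p (gen p g) = coprodGen p g := U.lift_gen ..

theorem rep_gen (g : UGen) : rep p (gen p g) = repGen p g := U.lift_gen ..

end Structure

end OSpq

namespace OSpq

open SuperAlgebra

/-! ### The quantum supergroup `OSp_q(1|2)` as the dual of `U_q[osp(1|2)]` -/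

section Dual

variable (p : ℂˣ)

/-- The product of functionals on `U_q[osp(1|2)]` that is dual to the coproduct: if `f` has parity
`n`, then `⟨X, f g⟩ = ∑ (-1)^(n |X₂|) ⟨X₁, f⟩ ⟨X₂, g⟩`, where `Δ(X) = ∑ X₁ ⊗ X₂`. -/
def conv (n : ℕ) (f g : U p →ₗ[ℂ] ℂ) : U p →ₗ[ℂ] ℂ :=
  LinearMap.mul' ℂ ℂ ∘ₗ TensorProduct.map f (g ∘ₗ ((parity : U p →ₐ[ℂ] U p) ^ n).toLinearMap) ∘ₗ
    (GradedTensorProduct.of ℂ (part (U p)) (part (U p))).symm.toLinearMap ∘ₗ (coprod p).toLinearMap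

/-- The functional `⟨·, T_{m'm}⟩`, that is
`⟨X, T_{m'm}⟩ = (-1)^(|X| (1 - m')) D_{m'm}(X)`. -/
def matrixCoeff (m' m : SignType) : U p →ₗ[ℂ] ℂ :=
  Matrix.entryLinearMap ℂ ℂ m' m ∘ₗ (rep p).toLinearMap ∘ₗ
    ((parity : U p →ₐ[ℂ] U p) ^ par m').toLinearMap

/-- Left multiplication by `T_{m'm}`, an element of parity `m' + m`, on functionals. -/
def convLeft (t : SignType × SignType) : Module.End ℂ (U p →ₗ[ℂ] ℂ) where
  toFun g := conv p (par t.1 + par t.2) (matrixCoeff p t.1 t.2) g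
  map_add' g h := by
    ext X
    simp only [conv, LinearMap.add_comp, TensorProduct.map_add_right, LinearMap.comp_add,
      LinearMap.add_apply]
  map_smul' c g := by
    ext X
    simp only [conv, LinearMap.smul_comp, TensorProduct.map_smul_right, LinearMap.comp_smul,
      LinearMap.smul_apply, RingHom.id_apply]

/-- The functional on `U_q[osp(1|2)]` given by a noncommutative polynomial in the matrix entries
`T_{m'm}`; the empty monomial is the counit. -/
def pairing (f : FreeAlgebra ℂ (SignType × SignType)) : U p →ₗ[ℂ] ℂ :=
  FreeAlgebra.lift ℂ (convLeft p) f (counit p).toLinearMap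

/-- Two polynomials in the matrix entries are identified if they agree as functionals. -/
def ARel (f g : FreeAlgebra ℂ (SignType × SignType)) : Prop :=
  ∀ X : U p, pairing p f X = pairing p g X

/-- The algebra `OSp_q(1|2)`, generated by the entries of `T = T^{(1)}(0)` inside the dual of
`U_q[osp(1|2)]`. -/
abbrev A : Type := RingQuot (ARel p)

/-- The entry `T_{m'm}` of the corepresentation matrix `T^{(1)}(0)`. -/
def A.T (m' m : SignType) : A p := RingQuot.mkAlgHom ℂ (ARel p) (FreeAlgebra.ι ℂ (m', m))

theorem coprod_parity (X : U p) : coprod p (parity X) = parityTensor (coprod p X) := by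
  have : (coprod p).comp parity = parityTensor.comp (coprod p) := by
    apply U.hom_ext
    intro g
    have hK : parityTensor (coprodGen p .K) = coprodGen p .K := by
      simp only [coprodGen, parityTensor_tmul, parity_K]
    have hKi : parityTensor (coprodGen p .Kinv) = coprodGen p .Kinv := by
      simp only [coprodGen, parityTensor_tmul, parity_Kinv]
    have hvp : parityTensor (coprodGen p .vp) = -coprodGen p .vp := by
      simp only [coprodGen, map_add, parityTensor_tmul, parity_K, parity_Kinv, parity_vp,
        GradedTensorProduct.tmul, TensorProduct.neg_tmul, TensorProduct.tmul_neg, map_neg]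
      abel
    have hvm : parityTensor (coprodGen p .vm) = -coprodGen p .vm := by
      simp only [coprodGen, map_add, parityTensor_tmul, parity_K, parity_Kinv, parity_vm,
        GradedTensorProduct.tmul, TensorProduct.neg_tmul, TensorProduct.tmul_neg, map_neg]
      abel
    cases g
    · simp only [AlgHom.comp_apply, parity_K, coprod_gen, hK]
    · simp only [AlgHom.comp_apply, parity_Kinv, coprod_gen, hKi]
    · simp only [AlgHom.comp_apply, parity_vp, map_neg, coprod_gen, hvp]
    · simp only [AlgHom.comp_apply, parity_vm, map_neg, coprod_gen, hvm]
  exact DFunLike.congr_fun this X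

theorem counit_parity (X : U p) : counit p (parity X) = counit p X := by
  have : (counit p).comp parity = counit p := by
    apply U.hom_ext
    intro g
    cases g <;> simp [parity_K, parity_Kinv, parity_vp, parity_vm, counit]
  exact DFunLike.congr_fun this X

theorem rep_parity (X : U p) (i j : SignType) :
    rep p (parity X) i j = (-1) ^ (par i + par j) * rep p X i j := by
  induction X using U.induction generalizing i j with
  | gen g =>
    cases g <;> simp [parity_K, parity_Kinv, parity_vp, parity_vm, rep_gen] <;>
      cases i <;> cases j <;> simp [repGen, par]
  | scalar c =>
    rw [AlgHom.commutes, AlgHom.commutes, Matrix.algebraMap_matrix_apply]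
    split_ifs with h
    · subst h; rw [← two_mul, pow_mul]; simp
    · simp
  | add x y hx hy => simp [hx, hy, mul_add]
  | mul x y hx hy =>
    simp only [map_mul, Matrix.mul_apply, hx, hy, Finset.mul_sum]
    refine Finset.sum_congr rfl fun k _ => ?_
    have : ((-1 : ℂ) ^ par k) * (-1) ^ par k = 1 := by rw [← mul_pow]; simp
    rw [pow_add, pow_add, pow_add]
    linear_combination (-1 : ℂ) ^ par i * (-1) ^ par j * rep p x i k * rep p y k j * this

theorem parity_pow_comm (n : ℕ) (X : U p) : ((parity : U p →ₐ[ℂ] U p) ^ n) (parity X) =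
    parity (((parity : U p →ₐ[ℂ] U p) ^ n) X) := by
  change ((parity ^ n * parity : U p →ₐ[ℂ] U p)) X = (parity * parity ^ n : U p →ₐ[ℂ] U p) X
  rw [← pow_succ, ← pow_succ']

theorem matrixCoeff_parity (t : SignType × SignType) (X : U p) :
    matrixCoeff p t.1 t.2 (parity X) =
      (-1) ^ (par t.1 + par t.2) * matrixCoeff p t.1 t.2 X := by
  simp only [matrixCoeff, LinearMap.comp_apply, AlgHom.toLinearMap_apply, parity_pow_comm,
    Matrix.entryLinearMap_apply, rep_parity]

theorem convLeft_parity (t : SignType × SignType) (g : U p →ₗ[ℂ] ℂ) :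
    convLeft p t (g ∘ₗ parity.toLinearMap) =
      (-1 : ℂ) ^ (par t.1 + par t.2) • (convLeft p t g ∘ₗ parity.toLinearMap) := by
  ext X
  simp only [convLeft, LinearMap.coe_mk, AddHom.coe_mk, conv, LinearMap.comp_apply,
    AlgHom.toLinearMap_apply, LinearMap.smul_apply, coprod_parity, LinearEquiv.coe_coe]
  obtain ⟨Z, hZ⟩ := (GradedTensorProduct.of ℂ (part (U p)) (part (U p))).surjective (coprod p X)
  rw [← hZ]
  clear hZ
  induction Z using TensorProduct.induction_on with
  | zero => simp only [map_zero, smul_zero]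
  | add x y hx hy => simp only [map_add, smul_add, hx, hy]
  | tmul x y =>
    have hs : ((-1 : ℂ) ^ (par t.1 + par t.2)) * (-1) ^ (par t.1 + par t.2) = 1 := by
      rw [← mul_pow]; simp
    rw [parityTensor_tmul, GradedTensorProduct.tmul, GradedTensorProduct.of_symm_of,
      GradedTensorProduct.of_symm_of, TensorProduct.map_tmul, TensorProduct.map_tmul,
      LinearMap.mul'_apply, LinearMap.mul'_apply, matrixCoeff_parity]
    simp only [LinearMap.comp_apply, AlgHom.toLinearMap_apply, parity_pow_comm, smul_eq_mul]
    rw [← mul_assoc, ← mul_assoc, hs, one_mul]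

/-- The parity of the entry `T_{m'm}`. -/
def parT (t : SignType × SignType) : ℕ := par t.1 + par t.2

theorem pairing_parity (f : FreeAlgebra ℂ (SignType × SignType)) :
    pairing p (freeParity parT f) = pairing p f ∘ₗ parity.toLinearMap := by
  have key : ∀ φ : U p →ₗ[ℂ] ℂ, FreeAlgebra.lift ℂ (convLeft p) (freeParity parT f)
      (φ ∘ₗ parity.toLinearMap) =
        FreeAlgebra.lift ℂ (convLeft p) f φ ∘ₗ parity.toLinearMap := by
    induction f using FreeAlgebra.induction with
    | grade0 c =>
      intro φ
      rw [AlgHom.commutes, AlgHom.commutes, Module.algebraMap_end_apply,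
        Module.algebraMap_end_apply, LinearMap.smul_comp]
    | grade1 t =>
      intro φ
      rw [freeParity_ι, map_smul, FreeAlgebra.lift_ι_apply, LinearMap.smul_apply, convLeft_parity,
        smul_smul, parT, ← mul_pow]
      simp
    | mul x y hx hy =>
      intro φ
      rw [map_mul, map_mul, map_mul, Module.End.mul_apply, Module.End.mul_apply, hy, hx]
    | add x y hx hy =>
      intro φ
      rw [map_add, map_add, map_add, LinearMap.add_apply, LinearMap.add_apply, hy, hx,
        LinearMap.add_comp]
  have h := key (counit p).toLinearMap
  have hc : (counit p).toLinearMap ∘ₗ (parity : U p →ₐ[ℂ] U p).toLinearMap =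
      (counit p).toLinearMap := by
    ext X; exact counit_parity p X
  rw [hc] at h
  exact h

instance : SuperAlgebra (A p) := quotientSuper parT (ARel p) <| by
  intro f g h
  apply RingQuot.mkAlgHom_rel
  intro X
  rw [pairing_parity, pairing_parity]
  exact h (parity X)

end Dual

end OSpq

namespace OSpq

open SuperAlgebra

/-! ### The tensor square of the representation and the coupled bases -/

section Coupling

variable (p : ℂˣ)

/-- The tensor square of the representation `rep p`, the entry `((i', j'), (i, j))` being the
coefficient of `e_{i'} ⊗ e_{j'}` in the image of `e_i ⊗ e_j`; it uses the sign rule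
`(x ⊗ y) (e_i ⊗ e_j) = (-1)^(|y| |e_i|) x e_i ⊗ y e_j`. -/
def tensorRep (X : U p) : Matrix (SignType × SignType) (SignType × SignType) ℂ :=
  Matrix.of fun k' k =>
    LinearMap.mul' ℂ ℂ (TensorProduct.map
      (Matrix.entryLinearMap ℂ ℂ k'.1 k.1 ∘ₗ (rep p).toLinearMap)
      (Matrix.entryLinearMap ℂ ℂ k'.2 k.2 ∘ₗ (rep p).toLinearMap ∘ₗ
        ((parity : U p →ₐ[ℂ] U p) ^ par k.1).toLinearMap)
      ((GradedTensorProduct.of ℂ (part (U p)) (part (U p))).symm (coprod p X)))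

open scoped Matrix in
/-- The vector with coefficients `C` in the tensor square spans the component `L = 0`. -/
def IsCoupledZero (C : SignType × SignType → ℂ) : Prop :=
  ∀ X : U p, tensorRep p X *ᵥ C = counit p X • C

open scoped Matrix in
/-- The vectors with coefficients `C 1, C 0, C (-1)` in the tensor square transform as the standard
basis of the component `L = 1`. -/
def IsCoupledOne (C : SignType → SignType × SignType → ℂ) : Prop :=
  ∀ (X : U p) (M : SignType), tensorRep p X *ᵥ C M = ∑ M', rep p X M' M • C M'

/-- Clebsch-Gordan coefficients for `1 ⊗ 1 → 0`. -/
def cgZero : SignType × SignType → ℂ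
  | (.neg, .pos) => p
  | (.zero, .zero) => 1
  | (.pos, .neg) => -(p : ℂ)⁻¹
  | _ => 0

/-- Clebsch-Gordan coefficients for `1 ⊗ 1 → 1`; the first argument is the weight `M`. -/
def cgOne : SignType → SignType × SignType → ℂ
  | .pos, (.zero, .pos) => -(p : ℂ)
  | .pos, (.pos, .zero) => (p : ℂ)⁻¹
  | .zero, (.neg, .pos) => 1
  | .zero, (.zero, .zero) => (p : ℂ)⁻¹ + p
  | .zero, (.pos, .neg) => -1
  | .neg, (.neg, .zero) => p
  | .neg, (.zero, .neg) => -(p : ℂ)⁻¹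
  | _, _ => 0

/-- The composite `∑ C_{ij} z_i z_j` in an algebra. -/
def composite {B : Type*} [Ring B] [Algebra ℂ B] (C : SignType × SignType → ℂ)
    (z : SignType → B) : B :=
  ∑ k, C k • (z k.1 * z k.2)

end Coupling

/-! ### The coaction on noncommutative polynomials in the coordinates -/

section Coaction

variable (p : ℂˣ)

open GradedTensorProduct

instance : SuperAlgebra (FreeAlgebra ℂ SignType) where
  parity := freeParity par
  parity_parity := freeParity_freeParity par

/-- The right coaction `z_m ↦ ∑ z_{m'} ⊗ T_{m'm}` on the free superalgebra of the coordinates,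
extended multiplicatively. -/
def freeCoaction :
    FreeAlgebra ℂ SignType →ₐ[ℂ] part (FreeAlgebra ℂ SignType) ᵍ⊗[ℂ] part (A p) :=
  FreeAlgebra.lift ℂ fun m => ∑ m', FreeAlgebra.ι ℂ m' ᵍ⊗ₜ[ℂ] A.T p m' m

/-- The entries of `T^{(1)}(1)`: those of `T^{(1)}(0)` with the sign of the odd entries changed. -/
def A.T' (m' m : SignType) : A p := (-1 : ℂ) ^ (par m' + par m) • A.T p m' m

end Coaction

/-! ### The quantum superspace -/

section Plane

variable (p : ℂˣ) (r : ℂ)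

/-- `[n] = (q^{-n/2} - (-1)^n q^{n/2}) / (q^{-1/2} + q^{1/2})`. -/
def qint (n : ℕ) : ℂ := (((p : ℂ) ^ n)⁻¹ - (-1) ^ n * (p : ℂ) ^ n) / ((p : ℂ)⁻¹ + p)

/-- The defining relations of the quantum superspace, with `q = p²`. -/
def IsSuperspace {B : Type*} [Ring B] [Algebra ℂ B] (z : SignType → B) : Prop :=
  z 1 * z 0 = (p : ℂ) ^ 2 • (z 0 * z 1) ∧
  z 0 * z (-1) = (p : ℂ) ^ 2 • (z (-1) * z 0) ∧
  z 1 * z (-1) = ((p : ℂ) ^ 2) ^ 2 • (z (-1) * z 1) -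
    ((p : ℂ) ^ 2 * ((p : ℂ)⁻¹ + p) * r) • (1 : B) ∧
  z 0 ^ 2 = -(((p : ℂ) ^ 2)⁻¹ * qint p 2) • (z 1 * z (-1)) - (((p : ℂ) ^ 2)⁻¹ * r) • (1 : B)

open FreeAlgebra in
inductive PlaneRel : FreeAlgebra ℂ SignType → FreeAlgebra ℂ SignType → Prop
  | z1_z0 : PlaneRel (ι ℂ 1 * ι ℂ 0) ((p : ℂ) ^ 2 • (ι ℂ 0 * ι ℂ 1))
  | z0_zm : PlaneRel (ι ℂ 0 * ι ℂ (-1)) ((p : ℂ) ^ 2 • (ι ℂ (-1) * ι ℂ 0))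
  | z1_zm : PlaneRel (ι ℂ 1 * ι ℂ (-1)) (((p : ℂ) ^ 2) ^ 2 • (ι ℂ (-1) * ι ℂ 1) -
      ((p : ℂ) ^ 2 * ((p : ℂ)⁻¹ + p) * r) • 1)
  | z0_sq : PlaneRel (ι ℂ 0 ^ 2)
      (-(((p : ℂ) ^ 2)⁻¹ * qint p 2) • (ι ℂ 1 * ι ℂ (-1)) - (((p : ℂ) ^ 2)⁻¹ * r) • 1)

/-- The coordinate algebra of the quantum superspace. -/
abbrev Superspace : Type := RingQuot (PlaneRel p r)

/-- The coordinate `z_m`. -/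
def Superspace.z (m : SignType) : Superspace p r :=
  RingQuot.mkAlgHom ℂ (PlaneRel p r) (FreeAlgebra.ι ℂ m)

theorem par_one : par 1 = 0 := rfl
theorem par_zero : par 0 = 1 := rfl
theorem par_neg_one : par (-1) = 0 := rfl

instance : SuperAlgebra (Superspace p r) := quotientSuper par (PlaneRel p r) <| by
  intro a b h
  have h' := RingQuot.mkAlgHom_rel ℂ h
  cases h <;>
    simp only [map_mul, map_sub, map_neg, map_smul, map_pow, map_one, freeParity_ι, par_one, par_zero,
      par_neg_one, pow_zero, pow_one, one_smul, neg_smul, mul_neg, neg_mul, smul_neg, neg_sq, neg_inj]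
      at h' ⊢
  · rw [h']
  · rw [h']
  · exact h'
  · exact h'

end Plane

/-! ### Superalgebras generated by the coordinates over a superalgebra of parameters -/

section Parameters

variable (Λ : Type*) [Ring Λ] [Algebra ℂ Λ] [SuperAlgebra Λ]

/-- Even elements are central and odd elements anticommute. -/
def IsSupercommutative : Prop :=
  (∀ a b : Λ, parity a = a → a * b = b * a) ∧
    ∀ a b : Λ, parity a = -a → parity b = -b → a * b = -(b * a)

/-- The free left module on the words in the coordinates, which is the underlying module of the free
superalgebra over `Λ` on the even `z_1`, `z_{-1}` and the odd `z_0`. -/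
abbrev Words : Type _ := List SignType →₀ Λ

variable {Λ}

/-- The element `∑ C_{ij} z_i z_j`. -/
def compositeWords (C : SignType × SignType → ℂ) : Words Λ :=
  ∑ k, Finsupp.single [k.1, k.2] (algebraMap ℂ Λ (C k))

variable (Λ) in
/-- The `L = 0` relation `E^0_0 = r`, written as `E^0_0 - r`. -/
def relatorZero (p : ℂˣ) (r : ℂ) : Words Λ :=
  compositeWords (cgZero p) - Finsupp.single [] (algebraMap ℂ Λ r)

/-- The `L = 1` relation `E^1_M = ξ z_M`, written as `E^1_M - ξ z_M`. -/
def relatorOne (p : ℂˣ) (ξ : Λ) (M : SignType) : Words Λ :=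
  compositeWords (cgOne p M) - Finsupp.single [M] ξ

/-- The `L = 1` relations. -/
def relatorsOne (p : ℂˣ) (ξ : Λ) : Set (Words Λ) := Set.range (relatorOne p ξ)

/-- The `L = 0` and `L = 1` relations. -/
def relators (p : ℂˣ) (r : ℂ) (ξ : Λ) : Set (Words Λ) :=
  insert (relatorZero Λ p r) (relatorsOne p ξ)

/-- The value of a combination of words, the coefficients being sent to `R` by `j`. -/
def evalWords {R : Type*} [Ring R] (j : Λ → R) (z : SignType → R) (f : Words Λ) : R :=
  f.sum fun w c => j c * (w.map z).prod

/-- The relations of the superalgebra over `Λ` that is generated by the coordinates subject to the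
relators `S`: coefficients are added and multiplied as in `Λ`, and they supercommute with the
coordinates. -/
inductive SpaceRel (S : Set (Words Λ)) :
    FreeAlgebra ℂ (Λ ⊕ SignType) → FreeAlgebra ℂ (Λ ⊕ SignType) → Prop
  | add (a b : Λ) : SpaceRel S (FreeAlgebra.ι ℂ (.inl (a + b)))
      (FreeAlgebra.ι ℂ (.inl a) + FreeAlgebra.ι ℂ (.inl b))
  | mul (a b : Λ) : SpaceRel S (FreeAlgebra.ι ℂ (.inl (a * b)))
      (FreeAlgebra.ι ℂ (.inl a) * FreeAlgebra.ι ℂ (.inl b))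
  | scalar (c : ℂ) : SpaceRel S (FreeAlgebra.ι ℂ (.inl (algebraMap ℂ Λ c))) (algebraMap ℂ _ c)
  | comm (m : SignType) (a : Λ) : SpaceRel S
      (FreeAlgebra.ι ℂ (.inr m) * FreeAlgebra.ι ℂ (.inl a))
      (FreeAlgebra.ι ℂ (.inl ((parity : Λ → Λ)^[par m] a)) * FreeAlgebra.ι ℂ (.inr m))
  | relator (f : Words Λ) (hf : f ∈ S) : SpaceRel S
      (evalWords (fun a => FreeAlgebra.ι ℂ (.inl a)) (fun m => FreeAlgebra.ι ℂ (.inr m)) f) 0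

/-- The superalgebra over `Λ` generated by the coordinates subject to the relators `S`. -/
abbrev Space (S : Set (Words Λ)) : Type _ := RingQuot (SpaceRel S)

namespace Space

variable (S : Set (Words Λ))

/-- A coefficient, as an element of the algebra. -/
def coef (a : Λ) : Space S := RingQuot.mkAlgHom ℂ (SpaceRel S) (FreeAlgebra.ι ℂ (.inl a))

/-- The coordinate `z_m`. -/
def z (m : SignType) : Space S := RingQuot.mkAlgHom ℂ (SpaceRel S) (FreeAlgebra.ι ℂ (.inr m))

/-- The combination of the ordered monomials `z_{-1}^a z_0^ε z_1^b` with given coefficients. -/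
def orderedSum (c : ℕ × Fin 2 × ℕ →₀ Λ) : Space S :=
  c.sum fun k a => coef S a * (z S (-1) ^ k.1 * z S 0 ^ (k.2.1 : ℕ) * z S 1 ^ k.2.2)

/-- The ordered monomials are a basis over `Λ`. -/
def HasOrderedBasis : Prop := Function.Bijective (orderedSum S)

end Space

/-! ### Reordering of products, and the consistency conditions -/

/-- A word is ordered if it is of the form `z_{-1}^a z_0^ε z_1^b` with `ε = 0, 1`. -/
def IsOrdered (w : List SignType) : Prop := w.IsChain fun x y => x < y ∨ (x = y ∧ x ≠ 0)

/-- All words of `f` are ordered. -/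
def IsOrderedSum (f : Words Λ) : Prop := ∀ w ∈ f.support, IsOrdered w

/-- The product `u f v`, where the coefficients of `f` are moved to the left of `u`. -/
def insertWords (u v : List SignType) (f : Words Λ) : Words Λ :=
  f.sum fun w c => Finsupp.single (u ++ w ++ v) ((parity : Λ → Λ)^[(u.map par).sum] c)

/-- The reordering rule `z_x z_y = e` is a consequence of the relators: the pair is not in order, `e`
is, and `z_x z_y - e` is a combination of the relators with coefficients in `Λ`. -/
def IsRule (S : Set (Words Λ)) (x y : SignType) (e : Words Λ) : Prop :=
  ¬ IsOrdered [x, y] ∧ IsOrderedSum e ∧ Finsupp.single [x, y] 1 - e ∈ Submodule.span Λ S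

/-- One step of reordering: in one of the words, a neighbouring pair is replaced according to a
reordering rule. -/
def Step (S : Set (Words Λ)) (f g : Words Λ) : Prop :=
  ∃ (u v : List SignType) (x y : SignType) (e : Words Λ), IsRule S x y e ∧
    g = f.erase (u ++ x :: y :: v) + f (u ++ x :: y :: v) • insertWords u v e

/-- Any two ways of reordering a product of three coordinates give the same result. -/
def ReorderingConsistent (S : Set (Words Λ)) : Prop :=
  ∀ (x y t : SignType) (g₁ g₂ : Words Λ),
    Relation.ReflTransGen (Step S) (Finsupp.single [x, y, t] 1) g₁ → IsOrderedSum g₁ →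
    Relation.ReflTransGen (Step S) (Finsupp.single [x, y, t] 1) g₂ → IsOrderedSum g₂ → g₁ = g₂

/-- By the `L = 1` relations, the element `E^0_0`, which is to be set equal to the
constant `r`, commutes with all coordinates. -/
def RadiusCommutes (p : ℂˣ) (ξ : Λ) : Prop :=
  ∀ m : SignType, Commute (composite (cgZero p) (Space.z (relatorsOne p ξ)))
    (Space.z (relatorsOne p ξ) m)

/-- The relations for `L = 0` and `L = 1` are consistent: the constant `r` commutes with the
coordinates, and the result of reordering a product of three coordinates is unique. -/
def Consistent (p : ℂˣ) (r : ℂ) (ξ : Λ) : Prop :=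
  RadiusCommutes p ξ ∧ ReorderingConsistent (relators p r ξ)

end Parameters

end OSpq

end

namespace OSpq

open SuperAlgebra

/-! ### The quadratic relations, solved for the ordered products -/

section Relations

variable {B : Type*} [Ring B] [Algebra ℂ B]

/-! Write `p` for q^{1/2}. The proof has three independent strands.

Components of the tensor square. Since `p` is not a root of unity, `K` separates weights. An
invariant vector has weight zero, and annihilation by v₋ determines it from its z_0 z_0 coefficient
(`isCoupledZero_iff`). A standard triple is determined by its top vector, which has weight 1 and is
killed by v₊; v₋ then produces the other two (`isCoupledOne_iff`). That the listed coefficients do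
transform correctly is a finite check on generators, which extends to the whole algebra because the
action on V ⊗ V is multiplicative (`gradedRep_mul`).

Covariance. Up to a sign, the functional of a product of two matrix entries is an entry of the
action on V ⊗ V (`pairing_ι_mul_ι`). Contracting with Clebsch-Gordan coefficients therefore turns
the intertwining property into the formulas for φ(E^0) and φ(E^1_M). The computation only needs
coordinates of the right parity, so it applies to the free algebra and to P alike; in P it shows
that the defining relations are preserved, because they are equivalent to E^0 = r, E^1_M = 0
(`composite_iff_isSuperspace`).

Consistency. The relations give rules for z_1 z_0, z_0 z_{-1} and z_0². Reducing z_0 z_0 z_0 from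
the left and from the right yields opposite coefficients of z_{-1} z_1, because the odd ξ changes
sign when it passes z_0. The difference is a multiple of p²(p² - 1)ξ, so ξ = 0
(`eq_zero_of_reorderingConsistent`). For ξ = 0, left multiplication in ordered form defines
operators on the free module on ordered monomials which satisfy all relations
(`leftOp_isSuperspace`). Acting on the empty monomial recovers the coefficients, so the ordered
monomials are independent; the same formulas show that they span (`Space.hasOrderedBasis_zero`).
Reordering never changes the value in the algebra, so a basis implies unique results. Finally, E^0
is central by direct computation (`commute_composite_cgZero`). -/

theorem composite_cgZero (p : ℂˣ) (z : SignType → B) :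
    composite (cgZero p) z =
      (p : ℂ) • (z (-1) * z 1) + z 0 * z 0 - (p : ℂ)⁻¹ • (z 1 * z (-1)) := by
  -- The coefficients are defined by matching on constructors, while the expanded sum carries the
  -- literals 1, 0, -1; conditionals make them computable by `simp`.
  have h : ∀ i j, cgZero p (i, j) = if (i, j) = (-1, 1) then (p : ℂ) else
      if (i, j) = (0, 0) then 1 else if (i, j) = (1, -1) then -(p : ℂ)⁻¹ else 0 := by
    intro i j; cases i <;> cases j <;> simp [cgZero]
  simp only [composite, Fintype.sum_prod_type, sum_sign, h]
  simp
  module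

theorem composite_cgOne_one (p : ℂˣ) (z : SignType → B) :
    composite (cgOne p 1) z = (p : ℂ)⁻¹ • (z 1 * z 0) - (p : ℂ) • (z 0 * z 1) := by
  have h : ∀ i j, cgOne p 1 (i, j) = if (i, j) = (0, 1) then -(p : ℂ) else
      if (i, j) = (1, 0) then (p : ℂ)⁻¹ else 0 := by
    intro i j; change cgOne p .pos _ = _; cases i <;> cases j <;> simp [cgOne]
  simp only [composite, Fintype.sum_prod_type, sum_sign, h]
  simp
  module

theorem composite_cgOne_zero (p : ℂˣ) (z : SignType → B) :
    composite (cgOne p 0) z =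
      z (-1) * z 1 + ((p : ℂ)⁻¹ + p) • (z 0 * z 0) - z 1 * z (-1) := by
  have h : ∀ i j, cgOne p 0 (i, j) = if (i, j) = (-1, 1) then 1 else
      if (i, j) = (0, 0) then (p : ℂ)⁻¹ + p else if (i, j) = (1, -1) then -1 else 0 := by
    intro i j; change cgOne p .zero _ = _; cases i <;> cases j <;> simp [cgOne]
  simp only [composite, Fintype.sum_prod_type, sum_sign, h]
  simp
  module

theorem composite_cgOne_neg_one (p : ℂˣ) (z : SignType → B) :
    composite (cgOne p (-1)) z = (p : ℂ) • (z (-1) * z 0) - (p : ℂ)⁻¹ • (z 0 * z (-1)) := by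
  have h : ∀ i j, cgOne p (-1) (i, j) = if (i, j) = (-1, 0) then (p : ℂ) else
      if (i, j) = (0, -1) then -(p : ℂ)⁻¹ else 0 := by
    intro i j; change cgOne p .neg _ = _; cases i <;> cases j <;> simp [cgOne]
  simp only [composite, Fintype.sum_prod_type, sum_sign, h]
  simp
  module

theorem forall_signType {P : SignType → Prop} : (∀ m, P m) ↔ P 1 ∧ P 0 ∧ P (-1) :=
  ⟨fun h => ⟨h _, h _, h _⟩, fun ⟨h1, h2, h3⟩ m => by cases m <;> assumption⟩

theorem pow_ne_one_of_forall {p : ℂˣ} (hp : ∀ n : ℕ, 0 < n → p ^ n ≠ 1) {n : ℕ} (hn : 0 < n) :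
    (p : ℂ) ^ n ≠ 1 := fun h => hp n hn (by ext; simpa using h)

theorem qint_two {p : ℂˣ} (hp : ∀ n : ℕ, 0 < n → p ^ n ≠ 1) :
    qint p 2 = (p : ℂ)⁻¹ - p := by
  have h0 : (p : ℂ) ≠ 0 := p.ne_zero
  have h1 : (p : ℂ)⁻¹ + p ≠ 0 := by
    -- The denominator vanishes only if p² = -1, which would make p⁴ = 1.
    intro h
    have h2 : (p : ℂ) ^ 2 = -1 := by
      field_simp at h
      linear_combination h
    apply pow_ne_one_of_forall hp (n := 4) (by norm_num)
    linear_combination ((p : ℂ) ^ 2 - 1) * h2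
  rw [qint, div_eq_iff h1]
  field_simp
  ring

/-- The relations of the quantum superspace with all right hand sides in the order
`z_{-1}, z_0, z_1`. -/
theorem isSuperspace_iff_ordered {p : ℂˣ} (hp : ∀ n : ℕ, 0 < n → p ^ n ≠ 1) (r : ℂ)
    (z : SignType → B) : IsSuperspace p r z ↔
      z 1 * z 0 = (p : ℂ) ^ 2 • (z 0 * z 1) ∧
      z 0 * z (-1) = (p : ℂ) ^ 2 • (z (-1) * z 0) ∧
      z 1 * z (-1) = (p : ℂ) ^ 4 • (z (-1) * z 1) - (p * ((p : ℂ) ^ 2 + 1) * r) • (1 : B) ∧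
      z 0 * z 0 = ((p : ℂ) ^ 3 - p) • (z (-1) * z 1) - ((p : ℂ) ^ 2 * r) • (1 : B) := by
  have h0 : (p : ℂ) ≠ 0 := p.ne_zero
  rw [IsSuperspace, qint_two hp, sq (z 0)]
  generalize (p : ℂ) = x at *
  refine and_congr_right fun _ => and_congr_right fun _ => ?_
  have e : (x ^ 2 * (x⁻¹ + x) * r) = x * (x ^ 2 + 1) * r := by field_simp; ring
  rw [e, ← pow_mul]
  refine and_congr_right fun h => ?_
  rw [h]
  have : (-((x ^ 2)⁻¹ * (x⁻¹ - x))) •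
        (x ^ (2 * 2) • (z (-1) * z 1) - (x * (x ^ 2 + 1) * r) • (1 : B))
      - ((x ^ 2)⁻¹ * r) • (1 : B) =
      (x ^ 3 - x) • (z (-1) * z 1) - (x ^ 2 * r) • (1 : B) := by
    match_scalars <;> field_simp <;> ring
  rw [this]

/-- The relations M = ±1 each involve one pair of products. E^0 = r and E^1_0 = 0 form a linear
system for z_0² and z_1 z_{-1} with determinant p⁻², so they can be solved for these two products
and recovered from the solution. -/
theorem composite_iff_isSuperspace {p : ℂˣ} (hp : ∀ n : ℕ, 0 < n → p ^ n ≠ 1) (r : ℂ)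
    (z : SignType → B) :
    (composite (cgZero p) z = algebraMap ℂ B r ∧ ∀ M, composite (cgOne p M) z = 0) ↔
      IsSuperspace p r z := by
  have h0 : (p : ℂ) ≠ 0 := p.ne_zero
  rw [isSuperspace_iff_ordered hp, forall_signType, composite_cgZero, composite_cgOne_one,
    composite_cgOne_zero, composite_cgOne_neg_one, Algebra.algebraMap_eq_smul_one]
  generalize (p : ℂ) = x at *
  constructor
  · rintro ⟨h1, h2, h3, h4⟩
    refine ⟨?_, ?_, ?_, ?_⟩
    -- The products of coordinates act as atoms of a ℂ-module, and only their scalar coefficients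
    -- are compared.
    · linear_combination (norm := (match_scalars <;> field_simp <;> ring)) x • h2
    · linear_combination (norm := (match_scalars <;> field_simp <;> ring)) (-x) • h4
    · linear_combination (norm := (match_scalars <;> field_simp <;> ring))
        x ^ 2 • h3 - (x * (x ^ 2 + 1)) • h1
    · linear_combination (norm := (match_scalars <;> field_simp <;> ring))
        x • h3 - x ^ 2 • h1
  · rintro ⟨h1, h2, h3, h4⟩
    refine ⟨?_, ?_, ?_, ?_⟩
    · linear_combination (norm := (match_scalars <;> field_simp <;> ring))
        h4 - x⁻¹ • h3
    · linear_combination (norm := (match_scalars <;> field_simp <;> ring)) x⁻¹ • h1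
    · linear_combination (norm := (match_scalars <;> field_simp <;> ring))
        (x⁻¹ + x) • h4 - h3
    · linear_combination (norm := (match_scalars <;> field_simp <;> ring)) (-x⁻¹) • h2

end Relations

/-! ### Left multiplication on ordered monomials -/

section OrderedMonomials

/-- The left multiplication by `z_m` on the ordered monomials `z_{-1}^a z_0^ε z_1^b`, written in
ordered monomials. -/
noncomputable def leftOp (p : ℂˣ) (r : ℂ) : SignType → Module.End ℂ (ℕ × Fin 2 × ℕ →₀ ℂ)
  | .neg => Finsupp.linearCombination ℂ fun k => Finsupp.single (k.1 + 1, k.2.1, k.2.2) 1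
  | .zero => Finsupp.linearCombination ℂ fun k => (p : ℂ) ^ (2 * k.1) •
      if k.2.1 = 0 then Finsupp.single (k.1, 1, k.2.2) 1 else
        ((p : ℂ) ^ 3 - p) • Finsupp.single (k.1 + 1, 0, k.2.2 + 1) 1 -
          ((p : ℂ) ^ 2 * r) • Finsupp.single (k.1, 0, k.2.2) 1
  | .pos => Finsupp.linearCombination ℂ fun k =>
      (p : ℂ) ^ (4 * k.1 + 2 * (k.2.1 : ℕ)) • Finsupp.single (k.1, k.2.1, k.2.2 + 1) 1 -
        (p * ((p : ℂ) ^ 2 + 1) * r * ∑ i ∈ Finset.range k.1, ((p : ℂ) ^ 4) ^ i) •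
          Finsupp.single (k.1 - 1, k.2.1, k.2.2) 1

variable {p : ℂˣ} {r : ℂ}

theorem leftOp_neg_one_single (a : ℕ) (e : Fin 2) (b : ℕ) :
    leftOp p r (-1) (Finsupp.single (a, e, b) 1) = Finsupp.single (a + 1, e, b) 1 := by
  change leftOp p r .neg _ = _
  simp [leftOp]

theorem leftOp_zero_single_zero (a b : ℕ) :
    leftOp p r 0 (Finsupp.single (a, 0, b) 1) =
      (p : ℂ) ^ (2 * a) • Finsupp.single (a, 1, b) 1 := by
  change leftOp p r .zero _ = _
  simp [leftOp]

theorem leftOp_zero_single_one (a b : ℕ) :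
    leftOp p r 0 (Finsupp.single (a, 1, b) 1) = (p : ℂ) ^ (2 * a) •
      (((p : ℂ) ^ 3 - p) • Finsupp.single (a + 1, 0, b + 1) 1 -
          ((p : ℂ) ^ 2 * r) • Finsupp.single (a, 0, b) 1) := by
  change leftOp p r .zero _ = _
  simp only [leftOp, Finsupp.linearCombination_single, one_smul]
  rfl

theorem leftOp_one_single (a : ℕ) (e : Fin 2) (b : ℕ) :
    leftOp p r 1 (Finsupp.single (a, e, b) 1) =
      (p : ℂ) ^ (4 * a + 2 * (e : ℕ)) • Finsupp.single (a, e, b + 1) 1 -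
        (p * ((p : ℂ) ^ 2 + 1) * r * ∑ i ∈ Finset.range a, ((p : ℂ) ^ 4) ^ i) •
          Finsupp.single (a - 1, e, b) 1 := by
  change leftOp p r .pos _ = _
  simp only [leftOp, Finsupp.linearCombination_single, one_smul]

/-- This replaces the diamond lemma: operators on a space with the ordered monomials as basis
satisfy the relations, so the relations cannot force a linear dependence between ordered monomials.
-/
theorem leftOp_isSuperspace (hp : ∀ n : ℕ, 0 < n → p ^ n ≠ 1) :
    IsSuperspace p r (leftOp p r) := by
  have h0 : (p : ℂ) ≠ 0 := p.ne_zero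
  -- (p⁴ - 1) ∑ p^{4i} = p^{4a} - 1. In the relation for z_0² this reconciles the factor p^{4a} from
  -- moving z_0² past z_{-1}^a with the terms in r from moving z_1 past z_{-1}^a.
  have hS := fun a => mul_geom_sum ((p : ℂ) ^ 4) a
  rw [isSuperspace_iff_ordered hp]
  refine ⟨?_, ?_, ?_, ?_⟩ <;> refine Finsupp.lhom_ext' fun ⟨a, e, b⟩ => LinearMap.ext_ring ?_ <;>
    simp only [LinearMap.comp_apply, Finsupp.lsingle_apply, Module.End.mul_apply,
      LinearMap.smul_apply, LinearMap.sub_apply, Module.End.one_apply]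
  · obtain rfl | rfl : e = 0 ∨ e = 1 := by fin_cases e <;> simp
    · simp only [leftOp_one_single, leftOp_zero_single_zero, map_smul, map_sub]
      cases a with
      | zero =>
        simp [-Finsupp.smul_single]
      | succ a =>
        simp [-Finsupp.smul_single]
        match_scalars <;> ring
    · simp only [leftOp_one_single, leftOp_zero_single_one, map_smul, map_sub]
      cases a with
      | zero =>
        simp [-Finsupp.smul_single]
        match_scalars <;> ring
      | succ a =>
        simp only [add_tsub_cancel_right, Finset.sum_range_succ _ (a + 1)]
        generalize  ∑ i ∈ Finset.range (a + 1), ((p : ℂ) ^ 4) ^ i = s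
        simp [-Finsupp.smul_single]
        match_scalars <;> ring
  · obtain rfl | rfl : e = 0 ∨ e = 1 := by fin_cases e <;> simp
    · simp only [leftOp_neg_one_single, leftOp_zero_single_zero, map_smul]
      match_scalars; ring
    · simp only [leftOp_neg_one_single, leftOp_zero_single_one, map_smul, map_sub]
      match_scalars <;> ring
  · simp only [leftOp_neg_one_single, leftOp_one_single, map_smul, map_sub]
    cases a with
    | zero =>
      simp [-Finsupp.smul_single]
      match_scalars <;> ring
    | succ a =>
      simp only [add_tsub_cancel_right, geom_sum_succ (n := a + 1)]
      match_scalars <;> ring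
  · obtain rfl | rfl : e = 0 ∨ e = 1 := by fin_cases e <;> simp
    · simp only [leftOp_neg_one_single, leftOp_zero_single_zero, leftOp_zero_single_one,
        leftOp_one_single, map_smul, map_sub]
      specialize hS a
      cases a with
      | zero =>
        simp [-Finsupp.smul_single]
      | succ a =>
        simp only [add_tsub_cancel_right] at *
        generalize  ∑ i ∈ Finset.range (a + 1), ((p : ℂ) ^ 4) ^ i = s at *
        simp [-Finsupp.smul_single]
        match_scalars
        · ring
        · linear_combination p ^ 2 * r * hS
    · simp only [leftOp_neg_one_single, leftOp_zero_single_zero, leftOp_zero_single_one,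
        leftOp_one_single, map_smul, map_sub]
      specialize hS a
      cases a with
      | zero =>
        simp [-Finsupp.smul_single]
      | succ a =>
        simp only [add_tsub_cancel_right] at *
        generalize  ∑ i ∈ Finset.range (a + 1), ((p : ℂ) ^ 4) ^ i = s at *
        simp [-Finsupp.smul_single]
        match_scalars
        · ring
        · linear_combination p ^ 2 * r * hS

variable {B : Type*} [Ring B] [Algebra ℂ B] {z : SignType → B}

/-- The ordered monomial `z_{-1}^a z_0^ε z_1^b`. -/
def monomial (z : SignType → B) (k : ℕ × Fin 2 × ℕ) : B :=
  z (-1) ^ k.1 * z 0 ^ (k.2.1 : ℕ) * z 1 ^ k.2.2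

theorem zero_mul_neg_one_pow (h : z 0 * z (-1) = (p : ℂ) ^ 2 • (z (-1) * z 0)) (a : ℕ) :
    z 0 * z (-1) ^ a = (p : ℂ) ^ (2 * a) • (z (-1) ^ a * z 0) := by
  induction a with
  | zero => simp
  | succ a ih =>
    rw [pow_succ, ← mul_assoc, ih, smul_mul_assoc, mul_assoc, h, mul_smul_comm, smul_smul,
      ← mul_assoc]
    congr 1
    ring

/-- Each passage of z_1 over z_{-1} gives a factor p⁴ and an inhomogeneous term, whence the
geometric sum. At a = 0 the sum is empty, so the truncated exponent a - 1 does no harm. -/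
theorem one_mul_neg_one_pow {c : ℂ}
    (h : z 1 * z (-1) = (p : ℂ) ^ 4 • (z (-1) * z 1) - c • (1 : B)) (a : ℕ) :
    z 1 * z (-1) ^ a = (p : ℂ) ^ (4 * a) • (z (-1) ^ a * z 1) -
      (c * ∑ i ∈ Finset.range a, ((p : ℂ) ^ 4) ^ i) • z (-1) ^ (a - 1) := by
  induction a with
  | zero => simp
  | succ a ih =>
    have e : (∑ i ∈ Finset.range a, ((p : ℂ) ^ 4) ^ i) • (z (-1) ^ (a - 1) * z (-1)) =
        (∑ i ∈ Finset.range a, ((p : ℂ) ^ 4) ^ i) • z (-1) ^ a := by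
      cases a with
      | zero => simp
      | succ a => rw [add_tsub_cancel_right, pow_succ (z (-1))]
    rw [pow_succ (z (-1)), ← mul_assoc, ih, sub_mul, smul_mul_assoc, mul_assoc, h, smul_mul_assoc,
      mul_smul c, e, Finset.sum_range_succ, mul_sub, mul_smul_comm, mul_smul_comm, mul_one,
      ← mul_assoc, add_tsub_cancel_right]
    match_scalars <;> ring

/-- In every algebra with the relations, left multiplication by a coordinate follows the model
operator `leftOp`. This makes the span of the ordered monomials stable. -/
theorem mul_monomial (hp : ∀ n : ℕ, 0 < n → p ^ n ≠ 1) (hz : IsSuperspace p r z) (m : SignType)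
    (k : ℕ × Fin 2 × ℕ) : z m * monomial z k =
      Finsupp.linearCombination ℂ (monomial z) (leftOp p r m (Finsupp.single k 1)) := by
  rw [isSuperspace_iff_ordered hp] at hz
  obtain ⟨h1, h2, h3, h4⟩ := hz
  obtain ⟨a, e, b⟩ := k
  revert m
  rw [forall_signType]
  refine ⟨?_, ?_, ?_⟩
  · simp only [leftOp_one_single, map_sub, map_smul, Finsupp.linearCombination_single, one_smul,
      monomial]
    rw [← mul_assoc, ← mul_assoc, one_mul_neg_one_pow h3, sub_mul, sub_mul]
    obtain rfl | rfl : e = 0 ∨ e = 1 := by fin_cases e <;> simp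
    · simp [mul_assoc, pow_succ']
    · simp only [Fin.val_one, pow_one, smul_mul_assoc]
      rw [mul_assoc (z (-1) ^ a), h1, pow_succ' (z 1)]
      simp only [mul_smul_comm, smul_mul_assoc, mul_assoc]
      match_scalars <;> ring
  · obtain rfl | rfl : e = 0 ∨ e = 1 := by fin_cases e <;> simp
    · simp only [leftOp_zero_single_zero, map_smul, Finsupp.linearCombination_single, one_smul,
        monomial, ← mul_assoc, zero_mul_neg_one_pow h2]
      simp
    · simp only [leftOp_zero_single_one, map_smul, map_sub, Finsupp.linearCombination_single,
        one_smul, monomial, ← mul_assoc, zero_mul_neg_one_pow h2]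
      simp only [Fin.val_one, pow_one, smul_mul_assoc, mul_assoc _ (z 0) (z 0), h4]
      simp [mul_sub, sub_mul, pow_succ, mul_assoc]
      simp only [← pow_succ', ← pow_succ]
  · simp [leftOp_neg_one_single, monomial, pow_succ', mul_assoc]

end OrderedMonomials

/-! ### Words, their values, and invariance under reordering -/

section Evaluation

variable {Λ : Type*} [Ring Λ] {R : Type*} [Ring R]

/-- The word of the ordered monomial `z_{-1}^a z_0^ε z_1^b`. -/
def orderedWord (k : ℕ × Fin 2 × ℕ) : List SignType :=
  List.replicate k.1 (-1) ++ List.replicate k.2.1 0 ++ List.replicate k.2.2 1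

theorem prod_orderedWord (z : SignType → R) (k : ℕ × Fin 2 × ℕ) :
    ((orderedWord k).map z).prod = monomial z k := by
  simp [orderedWord, monomial, mul_assoc]

theorem exists_orderedWord {w : List SignType} (hw : IsOrdered w) : ∃ k, orderedWord k = w := by
  induction w with
  | nil => exact ⟨(0, 0, 0), rfl⟩
  | cons x w ih =>
    rw [IsOrdered, List.isChain_cons] at hw
    obtain ⟨⟨a, e, b⟩, rfl⟩ := ih hw.2
    have h := hw.1
    have he : e = 0 ∨ e = 1 := by fin_cases e <;> simp
    revert x
    rw [forall_signType]
    refine ⟨fun hw h => ?_, fun hw h => ?_, fun hw h => ?_⟩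
    · cases a with
      | succ a => exact absurd (h (-1) (by simp [orderedWord, List.replicate_succ])) (by decide)
      | zero =>
        obtain rfl | rfl := he
        · exact ⟨(0, 0, b + 1), by simp [orderedWord, List.replicate_succ]⟩
        · exact absurd (h 0 (by simp [orderedWord])) (by decide)
    · cases a with
      | succ a => exact absurd (h (-1) (by simp [orderedWord, List.replicate_succ])) (by decide)
      | zero =>
        obtain rfl | rfl := he
        · exact ⟨(0, 1, b), by simp [orderedWord]⟩
        · exact absurd (h 0 (by simp [orderedWord])) (by decide)
    · exact ⟨(a + 1, e, b), by simp [orderedWord, List.replicate_succ]⟩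

/-- Passes from ordered combinations of words to coefficient functions on the exponents (a, ε, b),
the form in which the basis property is stated. -/
theorem exists_mapDomain_orderedWord {f : Words Λ} (hf : IsOrderedSum f) :
    ∃ c : ℕ × Fin 2 × ℕ →₀ Λ, c.mapDomain orderedWord = f := by
  choose k hk using fun w : f.support => exists_orderedWord (hf w w.2)
  refine ⟨∑ w : f.support, Finsupp.single (k w) (f w), ?_⟩
  rw [Finsupp.mapDomain_finsetSum]
  simp only [Finsupp.mapDomain_single, hk]
  rw [Finset.sum_coe_sort f.support fun w => Finsupp.single w (f w)]
  exact f.sum_single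

variable [Algebra ℂ Λ] [Algebra ℂ R]

/-- The evaluation of combinations of words as an additive map. -/
noncomputable def evalHom (j : Λ →ₐ[ℂ] R) (z : SignType → R) : Words Λ →+ R :=
  Finsupp.liftAddHom fun w => (AddMonoidHom.mulRight (w.map z).prod).comp (j : Λ →+ R)

theorem evalHom_apply (j : Λ →ₐ[ℂ] R) (z : SignType → R) (f : Words Λ) :
    evalHom j z f = evalWords j z f := rfl

@[simp] theorem evalHom_single (j : Λ →ₐ[ℂ] R) (z : SignType → R) (w : List SignType) (c : Λ) :
    evalHom j z (Finsupp.single w c) = j c * (w.map z).prod := by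
  simp [evalHom]

theorem evalHom_smul (j : Λ →ₐ[ℂ] R) (z : SignType → R) (a : Λ) (f : Words Λ) :
    evalHom j z (a • f) = j a * evalHom j z f := by
  induction f using Finsupp.induction_linear with
  | zero => simp
  | add f g hf hg => rw [smul_add, map_add, hf, hg, map_add, mul_add]
  | single w c => rw [Finsupp.smul_single, evalHom_single, evalHom_single, smul_eq_mul, map_mul,
      mul_assoc]

theorem evalHom_eq_zero_of_mem_span {j : Λ →ₐ[ℂ] R} {z : SignType → R} {S : Set (Words Λ)}
    (h : ∀ f ∈ S, evalHom j z f = 0) {f : Words Λ} (hf : f ∈ Submodule.span Λ S) :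
    evalHom j z f = 0 := by
  induction hf using Submodule.span_induction with
  | mem f hf => exact h f hf
  | zero => exact map_zero _
  | add f g _ _ hf hg => rw [map_add, hf, hg, add_zero]
  | smul a f _ hf => rw [evalHom_smul, hf, mul_zero]

theorem evalHom_compositeWords (j : Λ →ₐ[ℂ] R) (z : SignType → R) (C : SignType × SignType → ℂ) :
    evalHom j z (compositeWords C) = composite C z := by
  simp [compositeWords, composite, map_sum, Algebra.smul_def]

theorem evalHom_relatorZero (j : Λ →ₐ[ℂ] R) (z : SignType → R) (p : ℂˣ) (r : ℂ) :
    evalHom j z (relatorZero Λ p r) = composite (cgZero p) z - algebraMap ℂ R r := by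
  simp [relatorZero, evalHom_compositeWords]

theorem evalHom_relatorOne (j : Λ →ₐ[ℂ] R) (z : SignType → R) (p : ℂˣ) (ξ : Λ) (M : SignType) :
    evalHom j z (relatorOne p ξ M) = composite (cgOne p M) z - j ξ * z M := by
  simp [relatorOne, evalHom_compositeWords]

theorem forall_relators {p : ℂˣ} {r : ℂ} {ξ : Λ} {P : Words Λ → Prop} :
    (∀ f ∈ relators p r ξ, P f) ↔ P (relatorZero Λ p r) ∧ ∀ M, P (relatorOne p ξ M) := by
  simp [relators, relatorsOne]

variable [SuperAlgebra Λ]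

theorem insertWords_single (u v w : List SignType) (c : Λ) :
    insertWords u v (Finsupp.single w c) =
      Finsupp.single (u ++ w ++ v) ((parity : Λ → Λ)^[(u.map par).sum] c) := by
  rw [insertWords, Finsupp.sum_single_index]
  rw [iterate_map_zero, Finsupp.single_zero]

theorem insertWords_add (u v : List SignType) (f g : Words Λ) :
    insertWords u v (f + g) = insertWords u v f + insertWords u v g := by
  rw [insertWords, Finsupp.sum_add_index']
  · rfl
  · intro w; rw [iterate_map_zero, Finsupp.single_zero]
  · intro w a b; rw [iterate_map_add, Finsupp.single_add]

theorem insertWords_zero (u v : List SignType) : insertWords u v (0 : Words Λ) = 0 := by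
  rw [insertWords, Finsupp.sum_zero_index]

theorem prod_mul_of_comm {j : Λ →ₐ[ℂ] R} {z : SignType → R}
    (hz : ∀ m a, z m * j a = j ((parity : Λ → Λ)^[par m] a) * z m) (u : List SignType) (a : Λ) :
    (u.map z).prod * j a = j ((parity : Λ → Λ)^[(u.map par).sum] a) * (u.map z).prod := by
  induction u generalizing a with
  | nil => simp
  | cons m u ih =>
    rw [List.map_cons, List.prod_cons, mul_assoc, ih, ← mul_assoc, hz, ← Function.iterate_add_apply,
      List.map_cons, List.sum_cons, mul_assoc]

/-- The parity twists in `insertWords` are exactly the signs that arise when coefficients are moved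
to the left of the word `u`. -/
theorem evalHom_insertWords {j : Λ →ₐ[ℂ] R} {z : SignType → R}
    (hz : ∀ m a, z m * j a = j ((parity : Λ → Λ)^[par m] a) * z m) (u v : List SignType)
    (f : Words Λ) :
    evalHom j z (insertWords u v f) = (u.map z).prod * evalHom j z f * (v.map z).prod := by
  induction f using Finsupp.induction_linear with
  | zero => simp [insertWords_zero]
  | add f g hf hg => rw [insertWords_add, map_add, hf, hg, map_add, mul_add, add_mul]
  | single w c =>
    rw [insertWords_single, evalHom_single, evalHom_single, ← mul_assoc, prod_mul_of_comm hz]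
    simp [mul_assoc]

/-- A rule differs from an equality of words by a Λ-combination of relators, which evaluates to
zero; inserting it between words keeps it zero. -/
theorem evalHom_step {j : Λ →ₐ[ℂ] R} {z : SignType → R}
    (hz : ∀ m a, z m * j a = j ((parity : Λ → Λ)^[par m] a) * z m) {S : Set (Words Λ)}
    (hS : ∀ f ∈ S, evalHom j z f = 0) {f g : Words Λ} (h : Step S f g) :
    evalHom j z g = evalHom j z f := by
  obtain ⟨u, v, x, y, e, ⟨-, -, he⟩, rfl⟩ := h
  have he := evalHom_eq_zero_of_mem_span hS he
  rw [map_sub, sub_eq_zero] at he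
  -- Splits off the one word that is rewritten; the rest of the combination is common to both sides.
  conv_rhs => rw [← Finsupp.erase_add_single (u ++ x :: y :: v) f]
  rw [map_add, map_add, evalHom_smul, evalHom_insertWords hz, ← he]
  simp [mul_assoc]

theorem evalHom_reflTransGen_step {j : Λ →ₐ[ℂ] R} {z : SignType → R}
    (hz : ∀ m a, z m * j a = j ((parity : Λ → Λ)^[par m] a) * z m) {S : Set (Words Λ)}
    (hS : ∀ f ∈ S, evalHom j z f = 0) {f g : Words Λ} (h : Relation.ReflTransGen (Step S) f g) :
    evalHom j z g = evalHom j z f := by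
  induction h with
  | refl => rfl
  | tail _ h ih => rw [evalHom_step hz hS h, ih]

end Evaluation

/-! ### The algebra over Λ and its basis of ordered monomials at ξ = 0 -/

namespace Space

section OrderedModule

variable {Λ : Type*} [Ring Λ] [Algebra ℂ Λ]

variable (Λ) in
/-- The free module over `Λ` on the ordered monomials. -/
def OrderedModule : Type _ := Λ ⊗[ℂ] (ℕ × Fin 2 × ℕ →₀ ℂ)

namespace OrderedModule

noncomputable instance : AddCommGroup (OrderedModule Λ) :=
  inferInstanceAs (AddCommGroup (Λ ⊗[ℂ] (ℕ × Fin 2 × ℕ →₀ ℂ)))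

noncomputable instance : Module ℂ (OrderedModule Λ) :=
  inferInstanceAs (Module ℂ (Λ ⊗[ℂ] (ℕ × Fin 2 × ℕ →₀ ℂ)))

/-- The combination of ordered monomials with coefficients in `ℂ`, multiplied by an element of
`Λ`. -/
noncomputable def tmul (a : Λ) (x : ℕ × Fin 2 × ℕ →₀ ℂ) : OrderedModule Λ := a ⊗ₜ x

theorem smul_tmul (c : ℂ) (a : Λ) (x : ℕ × Fin 2 × ℕ →₀ ℂ) : c • tmul a x = tmul a (c • x) :=
  (TensorProduct.tmul_smul c a x).symm

theorem tmul_zero (a : Λ) : tmul a 0 = 0 :=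
  TensorProduct.tmul_zero _ a

theorem hom_ext {f g : Module.End ℂ (OrderedModule Λ)} (h : ∀ a x, f (tmul a x) = g (tmul a x)) :
    f = g :=
  TensorProduct.ext' h

/-- The action of a linear map of `Λ` and of a linear map of combinations of ordered monomials. -/
noncomputable def map (f : Module.End ℂ Λ) (g : Module.End ℂ (ℕ × Fin 2 × ℕ →₀ ℂ)) :
    Module.End ℂ (OrderedModule Λ) :=
  TensorProduct.map f g

theorem map_tmul (f : Module.End ℂ Λ) (g : Module.End ℂ (ℕ × Fin 2 × ℕ →₀ ℂ)) (a : Λ)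
    (x : ℕ × Fin 2 × ℕ →₀ ℂ) : map f g (tmul a x) = tmul (f a) (g x) := rfl

/-- The coefficients of the ordered monomials. -/
noncomputable def repr : OrderedModule Λ →ₗ[ℂ] ℕ × Fin 2 × ℕ →₀ Λ :=
  (TensorProduct.finsuppScalarRight ℂ ℂ Λ _).toLinearMap

theorem repr_tmul_single (a : Λ) (k : ℕ × Fin 2 × ℕ) :
    repr (tmul a (Finsupp.single k 1)) = Finsupp.single k a := by
  refine (TensorProduct.finsuppScalarRight_apply_tmul (S := ℂ) a _).trans ?_
  simp

/-- The action of the coefficients. -/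
noncomputable def coefOp : Λ →ₐ[ℂ] Module.End ℂ (OrderedModule Λ) where
  toFun a := map (LinearMap.mulLeft ℂ a) 1
  map_one' := hom_ext fun b x => by simp [map_tmul]
  map_mul' a b := hom_ext fun c x => by simp [map_tmul]
  map_zero' := hom_ext fun b x => by
    rw [map_tmul, LinearMap.mulLeft_zero_eq_zero]
    exact TensorProduct.zero_tmul _ _
  map_add' a b := hom_ext fun c x => by
    rw [LinearMap.add_apply, map_tmul, map_tmul, map_tmul, LinearMap.mulLeft_apply, add_mul]
    exact TensorProduct.add_tmul _ _ _
  commutes' c := hom_ext fun b x => by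
    rw [map_tmul, Module.algebraMap_end_apply, LinearMap.mulLeft_apply, ← Algebra.smul_def]
    exact (TensorProduct.smul_tmul' c b x).symm

theorem coefOp_tmul (a b : Λ) (x : ℕ × Fin 2 × ℕ →₀ ℂ) :
    coefOp a (tmul b x) = tmul (a * b) x := rfl

end OrderedModule

end OrderedModule

variable {Λ : Type*} [Ring Λ] [Algebra ℂ Λ] [SuperAlgebra Λ] (S : Set (Words Λ))

/-- The coefficients, as a homomorphism to the algebra. -/
noncomputable def coefHom : Λ →ₐ[ℂ] Space S :=
  have hc : ∀ c : ℂ, coef S (algebraMap ℂ Λ c) = algebraMap ℂ _ c := fun c => by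
    simpa [coef] using RingQuot.mkAlgHom_rel ℂ (SpaceRel.scalar (S := S) c)
  { toFun := coef S
    map_one' := by simpa using hc 1
    map_zero' := by simpa using hc 0
    map_mul' := fun a b => by simpa [coef] using RingQuot.mkAlgHom_rel ℂ (SpaceRel.mul (S := S) a b)
    map_add' := fun a b => by simpa [coef] using RingQuot.mkAlgHom_rel ℂ (SpaceRel.add (S := S) a b)
    commutes' := hc }

theorem coefHom_apply (a : Λ) : coefHom S a = coef S a := rfl

theorem z_mul_coefHom (m : SignType) (a : Λ) :
    z S m * coefHom S a = coefHom S ((parity : Λ → Λ)^[par m] a) * z S m := by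
  simpa [coef, z, coefHom_apply] using RingQuot.mkAlgHom_rel ℂ (SpaceRel.comm (S := S) m a)

theorem evalHom_eq_zero {f : Words Λ} (hf : f ∈ S) : evalHom (coefHom S) (z S) f = 0 := by
  have h := RingQuot.mkAlgHom_rel ℂ (SpaceRel.relator (S := S) f hf)
  rw [map_zero, evalWords, map_finsuppSum] at h
  rw [evalHom_apply, evalWords, ← h]
  refine Finsupp.sum_congr fun w _ => ?_
  rw [map_mul, map_list_prod, List.map_map]
  rfl

theorem induction {P : Space S → Prop} (coef : ∀ a, P (coefHom S a)) (z : ∀ m, P (z S m))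
    (add : ∀ x y, P x → P y → P (x + y)) (mul : ∀ x y, P x → P y → P (x * y)) (x : Space S) :
    P x := by
  obtain ⟨f, rfl⟩ := RingQuot.mkAlgHom_surjective ℂ (SpaceRel S) x
  induction f using FreeAlgebra.induction with
  | grade0 c => rw [AlgHom.commutes, ← (coefHom S).commutes]; exact coef _
  | grade1 g =>
    cases g with
    | inl a => exact coef a
    | inr m => exact z m
  | mul x y hx hy => rw [map_mul]; exact mul _ _ hx hy
  | add x y hx hy => rw [map_add]; exact add _ _ hx hy

/-- The universal property of the superalgebra generated by the coordinates over `Λ`. -/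
noncomputable def lift {R : Type*} [Ring R] [Algebra ℂ R] (j : Λ →ₐ[ℂ] R) (ζ : SignType → R)
    (hζ : ∀ m a, ζ m * j a = j ((parity : Λ → Λ)^[par m] a) * ζ m)
    (hS : ∀ f ∈ S, evalHom j ζ f = 0) : Space S →ₐ[ℂ] R :=
  RingQuot.liftAlgHom ℂ ⟨FreeAlgebra.lift ℂ (Sum.elim j ζ), by
    intro a b h
    cases h with
    | add a b => simp
    | mul a b => simp
    | scalar c => simp
    | comm m a => simpa using hζ m a
    | relator f hf =>
      rw [map_zero, evalWords, map_finsuppSum, ← hS f hf, evalHom_apply, evalWords]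
      refine Finsupp.sum_congr fun w _ => ?_
      rw [map_mul, map_list_prod, List.map_map]
      simp [Function.comp_def]⟩

theorem lift_coefHom {R : Type*} [Ring R] [Algebra ℂ R] (j : Λ →ₐ[ℂ] R) (ζ : SignType → R) (hζ hS)
    (a : Λ) : lift S j ζ hζ hS (coefHom S a) = j a := by
  simp [lift, coefHom_apply, coef]

theorem lift_z {R : Type*} [Ring R] [Algebra ℂ R] (j : Λ →ₐ[ℂ] R) (ζ : SignType → R) (hζ hS)
    (m : SignType) : lift S j ζ hζ hS (z S m) = ζ m := by
  simp [lift, z]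

/-- The combination of ordered monomials as an additive function of the coefficients. -/
noncomputable def orderedHom : (ℕ × Fin 2 × ℕ →₀ Λ) →+ Space S :=
  Finsupp.liftAddHom fun k => (AddMonoidHom.mulRight (monomial (z S) k)).comp
    (coefHom S : Λ →+ Space S)

theorem orderedHom_apply (c : ℕ × Fin 2 × ℕ →₀ Λ) : orderedHom S c = orderedSum S c := rfl

theorem orderedHom_single (k : ℕ × Fin 2 × ℕ) (a : Λ) :
    orderedHom S (Finsupp.single k a) = coefHom S a * monomial (z S) k := by
  simp [orderedHom]

theorem evalHom_mapDomain_orderedWord (c : ℕ × Fin 2 × ℕ →₀ Λ) :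
    evalHom (coefHom S) (z S) (c.mapDomain orderedWord) = orderedSum S c := by
  rw [← orderedHom_apply]
  induction c using Finsupp.induction_linear with
  | zero => simp
  | add f g hf hg => rw [Finsupp.mapDomain_add, map_add, hf, hg, map_add]
  | single k a =>
    rw [Finsupp.mapDomain_single, evalHom_single, prod_orderedWord, orderedHom_single]

/-- If the ordered monomials are linearly independent, then the result of reordering is unique. -/
theorem reorderingConsistent_of_hasOrderedBasis (h : HasOrderedBasis S) :
    ReorderingConsistent S := by
  intro x y t g₁ g₂ h₁ o₁ h₂ o₂
  -- Both results have the value of the original product in the algebra.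
  have e₁ := evalHom_reflTransGen_step (z_mul_coefHom S) (fun _ => evalHom_eq_zero S) h₁
  have e₂ := evalHom_reflTransGen_step (z_mul_coefHom S) (fun _ => evalHom_eq_zero S) h₂
  obtain ⟨c₁, rfl⟩ := exists_mapDomain_orderedWord o₁
  obtain ⟨c₂, rfl⟩ := exists_mapDomain_orderedWord o₂
  rw [evalHom_mapDomain_orderedWord] at e₁ e₂
  rw [h.1 (e₁.trans e₂.symm)]

variable {p : ℂˣ} {r : ℂ}

theorem isSuperspace_z (hp : ∀ n : ℕ, 0 < n → p ^ n ≠ 1) :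
    IsSuperspace p r (z (relators p r (0 : Λ))) := by
  rw [← composite_iff_isSuperspace hp]
  have h := forall_relators.1 fun f hf => evalHom_eq_zero (relators p r (0 : Λ)) hf
  simpa only [evalHom_relatorZero, evalHom_relatorOne, map_zero, zero_mul, sub_zero,
    sub_eq_zero] using h

/-- The combinations of ordered monomials form a left ideal containing 1. -/
theorem orderedSum_surjective (hp : ∀ n : ℕ, 0 < n → p ^ n ≠ 1) :
    Function.Surjective (orderedSum (relators p r (0 : Λ))) := by
  set S := relators p r (0 : Λ)
  have hz : IsSuperspace p r (z S) := isSuperspace_z hp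
  have hmono : ∀ a k, coefHom S a * monomial (z S) k ∈ (orderedHom S).range := fun a k =>
    ⟨_, orderedHom_single S k a⟩
  have key : ∀ x : Space S, ∀ y ∈ (orderedHom S).range, x * y ∈ (orderedHom S).range := by
    intro x
    induction x using induction with
    | coef a =>
      rintro _ ⟨c, rfl⟩
      induction c using Finsupp.induction_linear with
      | zero => simp [zero_mem]
      | add f g hf hg => rw [map_add, mul_add]; exact add_mem hf hg
      | single k b =>
        rw [orderedHom_single, ← mul_assoc, ← map_mul]
        exact hmono _ _
    | z m =>
      rintro _ ⟨c, rfl⟩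
      induction c using Finsupp.induction_linear with
      | zero => simp [zero_mem]
      | add f g hf hg => rw [map_add, mul_add]; exact add_mem hf hg
      | single k b =>
        rw [orderedHom_single, ← mul_assoc, z_mul_coefHom, mul_assoc, mul_monomial hp hz,
          Finsupp.linearCombination_apply, Finsupp.sum, Finset.mul_sum]
        refine sum_mem fun i _ => ?_
        -- The coefficients produced by `leftOp` are complex numbers; regarded as elements of Λ they
        -- merge with the coefficient in front.
        rw [Algebra.smul_def, ← (coefHom S).commutes, ← mul_assoc, ← map_mul]
        exact hmono _ _
    | add x y hx hy => intro w hw; rw [add_mul]; exact add_mem (hx w hw) (hy w hw)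
    | mul x y hx hy => intro w hw; rw [mul_assoc]; exact hx _ (hy w hw)
  intro x
  have h1 : (1 : Space S) ∈ (orderedHom S).range := by
    have := hmono 1 (0, 0, 0)
    simpa [monomial] using this
  obtain ⟨c, hc⟩ := key x 1 h1
  exact ⟨c, by rw [← orderedHom_apply, hc, mul_one]⟩

namespace OrderedModule

variable (Λ p r) in
/-- The action of `z_m`. -/
noncomputable def zOp (m : SignType) : Module.End ℂ (OrderedModule Λ) :=
  map ((parity : Λ →ₐ[ℂ] Λ).toLinearMap ^ par m) (leftOp p r m)

theorem zOp_tmul (m : SignType) (a : Λ) (x : ℕ × Fin 2 × ℕ →₀ ℂ) :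
    zOp Λ p r m (tmul a x) = tmul ((parity : Λ → Λ)^[par m] a) (leftOp p r m x) := by
  rw [zOp, map_tmul, Module.End.pow_apply]
  rfl

theorem zOp_mul_coefOp (m : SignType) (a : Λ) : zOp Λ p r m * coefOp a =
    coefOp ((parity : Λ → Λ)^[par m] a) * zOp Λ p r m := by
  have h : ∀ b, (parity : Λ → Λ)^[par m] (a * b) =
    (parity : Λ → Λ)^[par m] a * (parity : Λ → Λ)^[par m] b := iterate_map_mul parity (par m) a
  refine hom_ext fun b x => ?_
  rw [Module.End.mul_apply, Module.End.mul_apply, coefOp_tmul, zOp_tmul, zOp_tmul, coefOp_tmul, h]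

/-- Each term twists the Λ factor by the parity of its own product. If all terms with nonzero
coefficient have the same parity, the twist comes out and the identity reduces to one for `leftOp`.
-/
theorem composite_zOp_tmul (C : SignType × SignType → ℂ) (n : ℕ)
    (h : ∀ i a, C i ≠ 0 → (parity : Λ → Λ)^[par i.1 + par i.2] a = (parity : Λ → Λ)^[n] a)
    (a : Λ) (x : ℕ × Fin 2 × ℕ →₀ ℂ) :
    composite C (zOp Λ p r) (tmul a x) =
      tmul ((parity : Λ → Λ)^[n] a) (composite C (leftOp p r) x) := by
  have h' : ∀ i, (C i • (zOp Λ p r i.1 * zOp Λ p r i.2)) (tmul a x) =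
      tmul ((parity : Λ → Λ)^[n] a) ((C i • (leftOp p r i.1 * leftOp p r i.2)) x) := by
    intro i
    rw [LinearMap.smul_apply, LinearMap.smul_apply, Module.End.mul_apply, zOp_tmul, zOp_tmul,
      smul_tmul, ← Function.iterate_add_apply]
    by_cases hi : C i = 0
    · simp [hi, tmul_zero]
    · rw [h i a hi]
      rfl
  rw [composite, composite, LinearMap.sum_apply, LinearMap.sum_apply,
    Finset.sum_congr rfl fun i _ => h' i]
  exact (TensorProduct.tmul_sum _ _ _).symm

theorem evalHom_zOp (hp : ∀ n : ℕ, 0 < n → p ^ n ≠ 1) {f : Words Λ}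
    (hf : f ∈ relators p r (0 : Λ)) : evalHom coefOp (zOp Λ p r) f = 0 := by
  have hL := (composite_iff_isSuperspace hp r _).2 (leftOp_isSuperspace (r := r) hp)
  revert f
  rw [forall_relators]
  simp only [evalHom_relatorZero, evalHom_relatorOne, map_zero, zero_mul, sub_zero, sub_eq_zero]
  refine ⟨hom_ext fun a x => ?_, fun M => hom_ext fun a x => ?_⟩
  · rw [composite_zOp_tmul _ 0, hL.1, Module.algebraMap_end_apply, Module.algebraMap_end_apply,
      smul_tmul]
    · rfl
    · rintro ⟨i, j⟩ a h
      cases i <;> cases j <;> simp [cgZero, par, parity_parity] at h ⊢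
  -- The composite E^1_M has parity opposite to that of z_M.
  · rw [composite_zOp_tmul _ (par M + 1), hL.2, LinearMap.zero_apply, LinearMap.zero_apply,
      tmul_zero]
    rintro ⟨i, j⟩ a h
    cases M <;> cases i <;> cases j <;> simp [cgOne, par, parity_parity] at h ⊢

/-- The representation of the superalgebra on the free module over `Λ` on the ordered monomials. -/
noncomputable def toEnd (hp : ∀ n : ℕ, 0 < n → p ^ n ≠ 1) :
    Space (relators p r (0 : Λ)) →ₐ[ℂ] Module.End ℂ (OrderedModule Λ) :=
  lift _ coefOp (zOp Λ p r) zOp_mul_coefOp fun _ hf => evalHom_zOp hp hf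

/-- The empty monomial is a cyclic vector: z_1, z_0, z_{-1} applied in this order build up each
basis vector without correction terms, and no signs occur because 1 in Λ is even. -/
theorem toEnd_monomial (hp : ∀ n : ℕ, 0 < n → p ^ n ≠ 1) (k : ℕ × Fin 2 × ℕ) :
    toEnd hp (monomial (z (relators p r (0 : Λ))) k) (tmul 1 (Finsupp.single (0, 0, 0) 1)) =
      tmul 1 (Finsupp.single k 1) := by
  have hz : ∀ m x, zOp Λ p r m (tmul 1 x) = tmul 1 (leftOp p r m x) := by
    intro m x
    rw [zOp_tmul, Function.iterate_fixed (map_one parity)]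
  have h1 : ∀ b, (zOp Λ p r 1 ^ b) (tmul 1 (Finsupp.single (0, 0, 0) 1)) =
      tmul 1 (Finsupp.single (0, 0, b) 1) := by
    intro b
    induction b with
    | zero => simp
    | succ b ih => rw [pow_succ', Module.End.mul_apply, ih, hz, leftOp_one_single]; simp
  have h2 : ∀ (e : Fin 2) b, (zOp Λ p r 0 ^ (e : ℕ)) (tmul 1 (Finsupp.single (0, 0, b) 1)) =
      tmul 1 (Finsupp.single (0, e, b) 1) := by
    intro e b
    obtain rfl | rfl : e = 0 ∨ e = 1 := by fin_cases e <;> simp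
    · simp
    · simp [hz, leftOp_zero_single_zero]
  have h3 : ∀ a e b, (zOp Λ p r (-1) ^ a) (tmul 1 (Finsupp.single (0, e, b) 1)) =
      tmul 1 (Finsupp.single (a, e, b) 1) := by
    intro a e b
    induction a with
    | zero => simp
    | succ a ih => rw [pow_succ', Module.End.mul_apply, ih, hz, leftOp_neg_one_single]
  simp only [monomial, map_mul, map_pow, toEnd, lift_z, Module.End.mul_apply, h1, h2, h3]

/-- An explicit left inverse of `orderedSum`, which gives linear independence over Λ. -/
theorem repr_toEnd_orderedHom (hp : ∀ n : ℕ, 0 < n → p ^ n ≠ 1) (c : ℕ × Fin 2 × ℕ →₀ Λ) :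
    repr (toEnd hp (orderedHom (relators p r (0 : Λ)) c) (tmul 1 (Finsupp.single (0, 0, 0) 1))) =
      c := by
  induction c using Finsupp.induction_linear with
  | zero => simp
  | add f g hf hg => rw [map_add, map_add, LinearMap.add_apply, map_add, hf, hg]
  | single k a =>
    rw [orderedHom_single, map_mul, Module.End.mul_apply, toEnd_monomial, toEnd, lift_coefHom,
      coefOp_tmul, mul_one, repr_tmul_single]

end OrderedModule

theorem orderedSum_injective (hp : ∀ n : ℕ, 0 < n → p ^ n ≠ 1) :
    Function.Injective (orderedSum (relators p r (0 : Λ))) := by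
  intro c₁ c₂ h
  rw [← OrderedModule.repr_toEnd_orderedHom (r := r) hp c₁,
    ← OrderedModule.repr_toEnd_orderedHom (r := r) hp c₂, orderedHom_apply, orderedHom_apply, h]

theorem hasOrderedBasis_zero (hp : ∀ n : ℕ, 0 < n → p ^ n ≠ 1) :
    HasOrderedBasis (relators p r (0 : Λ)) :=
  ⟨orderedSum_injective hp, orderedSum_surjective hp⟩

end Space

/-- The L = 1 relations suffice to bring both products into a common form with z_{-1} left, z_0 in
the middle and z_1 right. Powers of z_0 stay unreduced, since without the L = 0 relation there is no
separate rule for z_0². -/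
theorem commute_composite_cgZero {B : Type*} [Ring B] [Algebra ℂ B] {p : ℂˣ} {z : SignType → B}
    (h : ∀ M, composite (cgOne p M) z = 0) (m : SignType) :
    Commute (composite (cgZero p) z) (z m) := by
  have h0 : (p : ℂ) ≠ 0 := p.ne_zero
  rw [forall_signType, composite_cgOne_one, composite_cgOne_zero, composite_cgOne_neg_one] at h
  obtain ⟨h1, h2, h3⟩ := h
  rw [composite_cgZero]
  generalize (p : ℂ) = x at *
  have h1 : z 1 * z 0 = x ^ 2 • (z 0 * z 1) := by
    linear_combination (norm := (match_scalars <;> field_simp <;> ring)) x • h1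
  have h3 : z 0 * z (-1) = x ^ 2 • (z (-1) * z 0) := by
    linear_combination (norm := (match_scalars <;> field_simp <;> ring)) (-x) • h3
  have h2 : z 1 * z (-1) = z (-1) * z 1 + (x⁻¹ + x) • (z 0 * z 0) := by
    linear_combination (norm := (match_scalars <;> field_simp <;> ring)) (-1 : ℂ) • h2
  -- The exchange rules are repeated with a trailing factor so that they apply inside
  -- right-associated products.
  have h1' : ∀ y, z 1 * (z 0 * y) = x ^ 2 • (z 0 * (z 1 * y)) := fun y => by
    rw [← mul_assoc, h1, smul_mul_assoc, mul_assoc]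
  have h3' : ∀ y, z 0 * (z (-1) * y) = x ^ 2 • (z (-1) * (z 0 * y)) := fun y => by
    rw [← mul_assoc, h3, smul_mul_assoc, mul_assoc]
  have h2' : ∀ y, z 1 * (z (-1) * y) = z (-1) * (z 1 * y) + (x⁻¹ + x) • (z 0 * (z 0 * y)) :=
    fun y => by
      rw [← mul_assoc, h2, add_mul, smul_mul_assoc, mul_assoc, mul_assoc]
  revert m
  rw [forall_signType]
  refine ⟨?_, ?_, ?_⟩ <;>
  · simp only [Commute, SemiconjBy, add_mul, sub_mul, mul_add, mul_sub, smul_mul_assoc,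
      mul_smul_comm, mul_assoc, h1, h2, h3, h1', h2', h3', smul_add, smul_smul]
    try (match_scalars <;> field_simp <;> ring)

theorem radiusCommutes_zero {Λ : Type*} [Ring Λ] [Algebra ℂ Λ] [SuperAlgebra Λ] (p : ℂˣ) :
    RadiusCommutes p (0 : Λ) := by
  refine commute_composite_cgZero fun M => ?_
  have h := Space.evalHom_eq_zero (relatorsOne p (0 : Λ)) ⟨M, rfl⟩
  rwa [evalHom_relatorOne, map_zero, zero_mul, sub_zero] at h

/-! ### The reordering rules and the overlap that forces ξ = 0 -/

section Reordering

variable {Λ : Type*} [Ring Λ]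

instance : DecidablePred IsOrdered := fun w =>
  inferInstanceAs (Decidable (w.IsChain fun x y => x < y ∨ (x = y ∧ x ≠ 0)))

theorem IsOrderedSum.single {w : List SignType} (hw : IsOrdered w) (c : Λ) :
    IsOrderedSum (Finsupp.single w c) := by
  intro v hv
  rwa [Finset.mem_singleton.1 (Finsupp.support_single_subset hv)]

theorem IsOrderedSum.add {f g : Words Λ} (hf : IsOrderedSum f) (hg : IsOrderedSum g) :
    IsOrderedSum (f + g) := by
  classical
  intro w hw
  rcases Finset.mem_union.1 (Finsupp.support_add hw) with h | h
  exacts [hf w h, hg w h]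

variable [Algebra ℂ Λ]

theorem compositeWords_cgZero (p : ℂˣ) :
    (compositeWords (cgZero p) : Words Λ) = (p : ℂ) • Finsupp.single [-1, 1] 1 +
      Finsupp.single [0, 0] 1 - (p : ℂ)⁻¹ • Finsupp.single [1, -1] 1 := by
  have h : ∀ i j, cgZero p (i, j) = if (i, j) = (-1, 1) then (p : ℂ) else
      if (i, j) = (0, 0) then 1 else if (i, j) = (1, -1) then -(p : ℂ)⁻¹ else 0 := by
    intro i j; cases i <;> cases j <;> simp [cgZero]
  simp only [compositeWords, Fintype.sum_prod_type, sum_sign, h, Algebra.algebraMap_eq_smul_one,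
    ← Finsupp.smul_single]
  simp [-Finsupp.smul_single]
  module

theorem compositeWords_cgOne_one (p : ℂˣ) :
    (compositeWords (cgOne p 1) : Words Λ) = (p : ℂ)⁻¹ • Finsupp.single [1, 0] 1 -
      (p : ℂ) • Finsupp.single [0, 1] 1 := by
  have h : ∀ i j, cgOne p 1 (i, j) = if (i, j) = (0, 1) then -(p : ℂ) else
      if (i, j) = (1, 0) then (p : ℂ)⁻¹ else 0 := by
    intro i j; change cgOne p .pos _ = _; cases i <;> cases j <;> simp [cgOne]
  simp only [compositeWords, Fintype.sum_prod_type, sum_sign, h, Algebra.algebraMap_eq_smul_one,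
    ← Finsupp.smul_single]
  simp [-Finsupp.smul_single]
  module

theorem compositeWords_cgOne_zero (p : ℂˣ) :
    (compositeWords (cgOne p 0) : Words Λ) = Finsupp.single [-1, 1] 1 +
      ((p : ℂ)⁻¹ + p) • Finsupp.single [0, 0] 1 - Finsupp.single [1, -1] 1 := by
  have h : ∀ i j, cgOne p 0 (i, j) = if (i, j) = (-1, 1) then 1 else
      if (i, j) = (0, 0) then (p : ℂ)⁻¹ + p else if (i, j) = (1, -1) then -1 else 0 := by
    intro i j; change cgOne p .zero _ = _; cases i <;> cases j <;> simp [cgOne]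
  simp only [compositeWords, Fintype.sum_prod_type, sum_sign, h, Algebra.algebraMap_eq_smul_one,
    ← Finsupp.smul_single]
  simp [-Finsupp.smul_single]
  module

theorem compositeWords_cgOne_neg_one (p : ℂˣ) :
    (compositeWords (cgOne p (-1)) : Words Λ) = (p : ℂ) • Finsupp.single [-1, 0] 1 -
      (p : ℂ)⁻¹ • Finsupp.single [0, -1] 1 := by
  have h : ∀ i j, cgOne p (-1) (i, j) = if (i, j) = (-1, 0) then (p : ℂ) else
      if (i, j) = (0, -1) then -(p : ℂ)⁻¹ else 0 := by
    intro i j; change cgOne p .neg _ = _; cases i <;> cases j <;> simp [cgOne]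
  simp only [compositeWords, Fintype.sum_prod_type, sum_sign, h, Algebra.algebraMap_eq_smul_one,
    ← Finsupp.smul_single]
  simp [-Finsupp.smul_single]
  module

theorem isRule_one_zero (p : ℂˣ) (r : ℂ) (ξ : Λ) : IsRule (relators p r ξ) 1 0
    (Finsupp.single [0, 1] (algebraMap ℂ Λ ((p : ℂ) ^ 2)) +
      Finsupp.single [1] ((p : ℂ) • ξ)) := by
  have h0 : (p : ℂ) ≠ 0 := p.ne_zero
  refine ⟨by decide, .add (.single (by decide) _) (.single (by decide) _), ?_⟩
  have h : relatorOne p ξ 1 ∈ Submodule.span Λ (relators p r ξ) :=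
    Submodule.subset_span (.inr ⟨1, rfl⟩)
  convert Submodule.smul_of_tower_mem _ (p : ℂ) h using 1
  rw [relatorOne, compositeWords_cgOne_one, Algebra.algebraMap_eq_smul_one, ← Finsupp.smul_single,
    ← Finsupp.smul_single]
  match_scalars <;> field_simp

theorem isRule_zero_neg_one (p : ℂˣ) (r : ℂ) (ξ : Λ) : IsRule (relators p r ξ) 0 (-1)
    (Finsupp.single [-1, 0] (algebraMap ℂ Λ ((p : ℂ) ^ 2)) +
      Finsupp.single [-1] (-((p : ℂ) • ξ))) := by
  have h0 : (p : ℂ) ≠ 0 := p.ne_zero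
  refine ⟨by decide, .add (.single (by decide) _) (.single (by decide) _), ?_⟩
  have h : relatorOne p ξ (-1) ∈ Submodule.span Λ (relators p r ξ) :=
    Submodule.subset_span (.inr ⟨-1, rfl⟩)
  convert Submodule.smul_of_tower_mem _ (-(p : ℂ)) h using 1
  rw [relatorOne, compositeWords_cgOne_neg_one, Algebra.algebraMap_eq_smul_one, ← neg_smul,
    ← Finsupp.smul_single, ← Finsupp.smul_single]
  match_scalars <;> field_simp

theorem isRule_zero_zero (p : ℂˣ) (r : ℂ) (ξ : Λ) : IsRule (relators p r ξ) 0 0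
    (Finsupp.single [-1, 1] (algebraMap ℂ Λ ((p : ℂ) ^ 3 - p)) +
      Finsupp.single [0] ((p : ℂ) • ξ) +
      Finsupp.single [] (algebraMap ℂ Λ (-((p : ℂ) ^ 2 * r)))) := by
  have h0 : (p : ℂ) ≠ 0 := p.ne_zero
  refine ⟨by decide, .add (.add (.single (by decide) _) (.single (by decide) _))
    (.single (by decide) _), ?_⟩
  have h : relatorOne p ξ 0 ∈ Submodule.span Λ (relators p r ξ) :=
    Submodule.subset_span (.inr ⟨0, rfl⟩)
  have h' : relatorZero Λ p r ∈ Submodule.span Λ (relators p r ξ) :=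
    Submodule.subset_span (.inl rfl)
  -- The combination p E^1_0 - p² E^0 of relators eliminates z_1 z_{-1} and leaves coefficient 1 at
  -- z_0².
  convert add_mem (Submodule.smul_of_tower_mem _ (p : ℂ) h)
    (Submodule.smul_of_tower_mem _ (-(p : ℂ) ^ 2) h') using 1
  rw [relatorOne, relatorZero, compositeWords_cgOne_zero, compositeWords_cgZero]
  simp only [Algebra.algebraMap_eq_smul_one, ← Finsupp.smul_single]
  match_scalars <;> field_simp <;> ring

variable [SuperAlgebra Λ]

/-- A step replaces the whole coefficient of the chosen word, so the remainder `g` must not contain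
that word. -/
theorem step_single_add {S : Set (Words Λ)} {x y : SignType} {e : Words Λ} (h : IsRule S x y e)
    (u v : List SignType) (c : Λ) {g : Words Λ} (hg : g (u ++ x :: y :: v) = 0) :
    Step S (Finsupp.single (u ++ x :: y :: v) c + g) (g + c • insertWords u v e) := by
  refine ⟨u, v, x, y, e, h, ?_⟩
  rw [Finsupp.erase_add, Finsupp.erase_single, zero_add, Finsupp.add_apply, Finsupp.single_eq_same,
    hg, add_zero, Finsupp.erase_of_notMem_support (Finsupp.notMem_support_iff.2 hg)]

/-- The overlap `z_0 z_0 z_0`. -/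
theorem add_mul_eq_of_reorderingConsistent {S : Set (Words Λ)} (h : ReorderingConsistent S)
    {a b c d : Λ} (ha : parity a = a) (hb : parity b = -b) (hd : parity d = d)
    (h₁ : IsRule S 1 0 (Finsupp.single [0, 1] c + Finsupp.single [1] b))
    (h₂ : IsRule S 0 (-1) (Finsupp.single [-1, 0] c + Finsupp.single [-1] (-b)))
    (h₀ : IsRule S 0 0
      (Finsupp.single [-1, 1] a + Finsupp.single [0] b + Finsupp.single [] d)) :
    a * b + b * a = -(a * b + b * a) := by
  -- First way: the left pair of z_0 z_0 z_0 is replaced, then z_1 z_0 in z_{-1} z_1 z_0, then the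
  -- remaining z_0 z_0.
  have A₁ := step_single_add h₀ [] [0] 1 (g := 0) rfl
  have A₂ := step_single_add h₁ [-1] [] a
    (g := Finsupp.single [0, 0] b + Finsupp.single [0] d) (by simp)
  have A₃ := step_single_add h₀ [] [] b
    (g := Finsupp.single [0] d + Finsupp.single [-1, 0, 1] (a * c) +
      Finsupp.single [-1, 1] (a * b)) (by simp)
  -- Second way: the right pair is replaced. The odd coefficient `b` now passes the leading z_0 and
  -- becomes `-b`; the rule for z_0 z_{-1} contributes a further `-b`.
  have B₁ := step_single_add h₀ [0] [] 1 (g := 0) rfl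
  have B₂ := step_single_add h₂ [] [1] a
    (g := Finsupp.single [0, 0] (-b) + Finsupp.single [0] d) (by simp)
  have B₃ := step_single_add h₀ [] [] (-b)
    (g := Finsupp.single [0] d + Finsupp.single [-1, 0, 1] (a * c) +
      Finsupp.single [-1, 1] (-(a * b))) (by simp)
  simp only [insertWords_add, insertWords_single, smul_add, Finsupp.smul_single, smul_eq_mul,
    List.nil_append, List.append_nil, List.cons_append, List.map_cons, List.map_nil, List.sum_cons,
    List.sum_nil, par_zero, par_neg_one, Function.iterate_zero, Function.iterate_one, id_eq,
    add_zero, zero_add, ha, hb, hd, one_mul, mul_neg, neg_mul, add_assoc] at A₁ A₂ A₃ B₁ B₂ B₃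
  have key := h 0 0 0 _ _
    (.tail (.tail (.single A₁) A₂) (by convert A₃ using 1)) ?_
    (.tail (.tail (.single B₁) B₂) (by convert B₃ using 1)) ?_
  -- The two results are compared at z_{-1} z_1.
  · have := DFunLike.congr_fun key [-1, 1]
    simpa [add_comm] using this
  all_goals
    repeat' apply IsOrderedSum.add
    all_goals exact .single (by decide) _

/-- Here a = p³ - p is a scalar and b = pξ, so the overlap gives 4p²(p² - 1)ξ = 0, with a nonzero
factor because p² ≠ 1. -/
theorem eq_zero_of_reorderingConsistent {p : ℂˣ} (hp : ∀ n : ℕ, 0 < n → p ^ n ≠ 1) {r : ℂ} {ξ : Λ}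
    (hξ : parity ξ = -ξ) (h : ReorderingConsistent (relators p r ξ)) : ξ = 0 := by
  have h0 : (p : ℂ) ≠ 0 := p.ne_zero
  have key := add_mul_eq_of_reorderingConsistent h (AlgHom.commutes _ _)
    (by rw [map_smul, hξ, smul_neg]) (AlgHom.commutes _ _)
    (isRule_one_zero p r ξ) (isRule_zero_neg_one p r ξ) (isRule_zero_zero p r ξ)
  rw [← Algebra.commutes, ← Algebra.smul_def, smul_smul] at key
  have hc : (4 * (((p : ℂ) ^ 3 - p) * p)) • ξ = 0 := by
    linear_combination (norm := module) key
  refine (smul_eq_zero.1 hc).resolve_left ?_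
  have h2 := sub_ne_zero.2 (pow_ne_one_of_forall hp (n := 2) (by norm_num))
  have e : 4 * (((p : ℂ) ^ 3 - p) * p) = 4 * (p : ℂ) ^ 2 * ((p : ℂ) ^ 2 - 1) := by ring
  rw [e]
  exact mul_ne_zero (mul_ne_zero (by norm_num) (pow_ne_zero _ h0)) h2

end Reordering

/-! ### Signs in graded tensor products and the action on the tensor square -/

open U GradedTensorProduct

section Homogeneous

variable {A B : Type*} [Ring A] [Algebra ℂ A] [SuperAlgebra A] [Ring B] [Algebra ℂ B]
  [SuperAlgebra B]

/-- Reduces to homogeneous elements. Parities are recorded as exponents of -1 in ℕ, so that sign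
rules become arithmetic of exponents. -/
theorem parity_induction {P : A → Prop}
    (hom : ∀ (n : ℕ) (a : A), parity a = (-1 : ℂ) ^ n • a → P a)
    (add : ∀ a b, P a → P b → P (a + b)) (a : A) : P a := by
  have h : a = (1 / 2 : ℂ) • (a + parity a) + (1 / 2 : ℂ) • (a - parity a) := by module
  rw [h]
  refine add _ _ (hom 0 _ ?_) (hom 1 _ ?_) <;> simp only [map_smul, map_add, map_sub, parity_parity]
  · module
  · module

theorem tmul_mul_tmul_of_parity (a : A) {a' : A} {b : B} (b' : B) {m n : ℕ}
    (hb : parity b = (-1 : ℂ) ^ m • b) (ha : parity a' = (-1 : ℂ) ^ n • a') :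
    (a ᵍ⊗ₜ[ℂ] b * a' ᵍ⊗ₜ[ℂ] b' : part A ᵍ⊗[ℂ] part B) =
      (-1 : ℂ) ^ (m * n) • (a * a') ᵍ⊗ₜ[ℂ] (b * b') := by
  rcases Nat.even_or_odd m with hm | hm
  · rw [hm.neg_one_pow, one_smul] at hb
    rw [tmul_mul_tmul_even_left _ _ _ _ hb, (hm.mul_right n).neg_one_pow, one_smul]
  · rcases Nat.even_or_odd n with hn | hn
    · rw [hn.neg_one_pow, one_smul] at ha
      rw [tmul_mul_tmul_even_right _ _ _ _ ha, (hn.mul_left m).neg_one_pow, one_smul]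
    · rw [hm.neg_one_pow, neg_one_smul] at hb
      rw [hn.neg_one_pow, neg_one_smul] at ha
      rw [tmul_mul_tmul_odd _ _ _ _ ha hb, (hm.mul hn).neg_one_pow, neg_one_smul]

theorem graded_induction {P : part A ᵍ⊗[ℂ] part B → Prop} (zero : P 0)
    (tmul : ∀ a b, P (a ᵍ⊗ₜ[ℂ] b)) (add : ∀ x y, P x → P y → P (x + y))
    (Z : part A ᵍ⊗[ℂ] part B) : P Z := by
  obtain ⟨Z, rfl⟩ := (GradedTensorProduct.of ℂ (part A) (part B)).surjective Z
  induction Z using TensorProduct.induction_on with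
  | zero => rw [map_zero]; exact zero
  | tmul a b => exact tmul a b
  | add x y hx hy => rw [map_add]; exact add _ _ hx hy

end Homogeneous

variable (p : ℂˣ)

theorem rep_parity_pow (n : ℕ) (X : U p) (i j : SignType) :
    rep p (((parity : U p →ₐ[ℂ] U p) ^ n) X) i j =
      (-1) ^ (n * (par i + par j)) * rep p X i j := by
  induction n with
  | zero => simp
  | succ n ih =>
    rw [pow_succ', AlgHom.mul_apply, rep_parity, ih, ← mul_assoc, ← pow_add]
    congr 2
    ring

/-- The action of a graded tensor on the tensor square of the representation. -/
noncomputable def gradedRep : part (U p) ᵍ⊗[ℂ] part (U p) →ₗ[ℂ]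
    Matrix (SignType × SignType) (SignType × SignType) ℂ :=
  LinearMap.pi fun k' => LinearMap.pi fun k =>
    LinearMap.mul' ℂ ℂ ∘ₗ TensorProduct.map
      (Matrix.entryLinearMap ℂ ℂ k'.1 k.1 ∘ₗ (rep p).toLinearMap)
      (Matrix.entryLinearMap ℂ ℂ k'.2 k.2 ∘ₗ (rep p).toLinearMap ∘ₗ
        ((parity : U p →ₐ[ℂ] U p) ^ par k.1).toLinearMap) ∘ₗ
      (GradedTensorProduct.of ℂ (part (U p)) (part (U p))).symm.toLinearMap

theorem tensorRep_eq_gradedRep (X : U p) : tensorRep p X = gradedRep p (coprod p X) := rfl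

theorem gradedRep_tmul (x y : U p) (k' k : SignType × SignType) :
    gradedRep p (x ᵍ⊗ₜ[ℂ] y) k' k = (-1) ^ (par k.1 * (par k'.2 + par k.2)) *
      (rep p x k'.1 k.1 * rep p y k'.2 k.2) := by
  rw [mul_left_comm, ← rep_parity_pow]
  rfl

/-- The sign rule for the graded product matches the sign rule for the action on V ⊗ V. For
homogeneous elements the matrix entries vanish unless their position has the right parity, and at
the surviving positions the signs agree. -/
theorem gradedRep_mul (Z W : part (U p) ᵍ⊗[ℂ] part (U p)) :
    gradedRep p (Z * W) = gradedRep p Z * gradedRep p W := by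
  induction Z using graded_induction with
  | zero => simp
  | add x y hx hy => rw [add_mul, map_add, hx, hy, map_add, add_mul]
  | tmul x y =>
  induction W using graded_induction with
  | zero => simp
  | add x y hx hy => rw [mul_add, map_add, hx, hy, map_add, mul_add]
  | tmul x' y' =>
  induction y using parity_induction with
  | add y₁ y₂ h₁ h₂ =>
    have e : (x ᵍ⊗ₜ[ℂ] (y₁ + y₂) : part (U p) ᵍ⊗[ℂ] part (U p)) = x ᵍ⊗ₜ[ℂ] y₁ + x ᵍ⊗ₜ[ℂ] y₂ := by
      simp only [tmul, TensorProduct.tmul_add, map_add]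
    rw [e, add_mul, map_add, map_add, h₁, h₂, add_mul]
  | hom m y hy =>
  induction x' using parity_induction with
  | add y₁ y₂ h₁ h₂ =>
    have e : ((y₁ + y₂) ᵍ⊗ₜ[ℂ] y' : part (U p) ᵍ⊗[ℂ] part (U p)) = y₁ ᵍ⊗ₜ[ℂ] y' + y₂ ᵍ⊗ₜ[ℂ] y' := by
      simp only [tmul, TensorProduct.add_tmul, map_add]
    rw [e, mul_add, map_add, map_add, h₁, h₂, mul_add]
  | hom n x' hx =>
  -- A homogeneous element has nonzero entries only where the parities of row and column add up to
  -- its own.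
  have hs : ∀ {X : U p} {n : ℕ}, parity X = (-1 : ℂ) ^ n • X → ∀ i j,
      rep p X i j = 0 ∨ (-1 : ℂ) ^ n = (-1) ^ (par i + par j) := by
    intro X n hX i j
    have h := rep_parity p X i j
    rw [hX, map_smul, Matrix.smul_apply, smul_eq_mul] at h
    exact (mul_eq_mul_right_iff.1 h).symm
  rw [tmul_mul_tmul_of_parity x y' hy hx]
  ext ⟨i', j'⟩ ⟨i, j⟩
  rw [map_smul, Matrix.smul_apply, gradedRep_tmul, Matrix.mul_apply, Fintype.sum_prod_type]
  simp only [gradedRep_tmul, map_mul, Matrix.mul_apply]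
  rw [Finset.sum_mul_sum, Finset.mul_sum, Finset.smul_sum]
  refine Finset.sum_congr rfl fun l _ => ?_
  rw [Finset.mul_sum, Finset.smul_sum]
  refine Finset.sum_congr rfl fun l' _ => ?_
  rcases hs hy j' l' with h | h
  · simp [h]
  rcases hs hx l i with h' | h'
  · simp [h']
  -- The parities of `y` and `x'` are replaced by those of the positions; the intermediate indices
  -- then give the same sign on both sides modulo 2.
  have e : (-1 : ℂ) ^ (m * n) * (-1) ^ (par i * (par j' + par j)) =
      (-1) ^ (par l * (par j' + par l')) * (-1) ^ (par i * (par l' + par j)) := by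
    have h2 : ((-1 : ℂ) ^ (par i * par j')) * (-1) ^ (par i * par j') = 1 := by
      rw [← mul_pow]; simp
    rw [pow_mul, h, pow_right_comm, h', ← pow_mul]
    simp only [mul_add, add_mul, pow_add]
    linear_combination ((-1 : ℂ) ^ (par l * par j') * (-1) ^ (par l * par l') *
      (-1) ^ (par i * par l') * (-1) ^ (par i * par j)) * h2
  rw [smul_eq_mul]
  linear_combination (rep p x i' l * rep p x' l i * (rep p y j' l' * rep p y' l' j)) * e

theorem tensorRep_mul (X Y : U p) : tensorRep p (X * Y) = tensorRep p X * tensorRep p Y := by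
  rw [tensorRep_eq_gradedRep, map_mul, gradedRep_mul]
  rfl

theorem tensorRep_add (X Y : U p) : tensorRep p (X + Y) = tensorRep p X + tensorRep p Y := by
  simp only [tensorRep_eq_gradedRep, map_add]

theorem tensorRep_algebraMap (c : ℂ) : tensorRep p (algebraMap ℂ _ c) = c • 1 := by
  rw [tensorRep_eq_gradedRep, AlgHom.commutes, Algebra.algebraMap_eq_smul_one, map_smul]
  congr 1
  change gradedRep p (1 ᵍ⊗ₜ[ℂ] 1) = _
  ext ⟨i', j'⟩ ⟨i, j⟩
  rw [gradedRep_tmul, map_one]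
  cases i' <;> cases j' <;> cases i <;> cases j <;> simp [par]

/-! ### The components L = 0 and L = 1 of the tensor square -/

section CoupledBases

open scoped Matrix

theorem tensorRep_K (k' k : SignType × SignType) : tensorRep p (gen p .K) k' k =
    repGen p .K k'.1 k.1 * repGen p .K k'.2 k.2 := by
  rw [tensorRep_eq_gradedRep, coprod_gen, coprodGen, gradedRep_tmul, rep_gen]
  obtain ⟨i', j'⟩ := k'
  obtain ⟨i, j⟩ := k
  cases j' <;> cases j <;> simp [repGen, par]

theorem tensorRep_Kinv (k' k : SignType × SignType) : tensorRep p (gen p .Kinv) k' k =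
    repGen p .Kinv k'.1 k.1 * repGen p .Kinv k'.2 k.2 := by
  rw [tensorRep_eq_gradedRep, coprod_gen, coprodGen, gradedRep_tmul, rep_gen]
  obtain ⟨i', j'⟩ := k'
  obtain ⟨i, j⟩ := k
  cases j' <;> cases j <;> simp [repGen, par]

theorem tensorRep_vp (k' k : SignType × SignType) : tensorRep p (gen p .vp) k' k =
    repGen p .vp k'.1 k.1 * repGen p .Kinv k'.2 k.2 +
      (-1) ^ par k.1 * (repGen p .K k'.1 k.1 * repGen p .vp k'.2 k.2) := by
  rw [tensorRep_eq_gradedRep, coprod_gen, coprodGen, map_add, Matrix.add_apply, gradedRep_tmul,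
    gradedRep_tmul, rep_gen, rep_gen, rep_gen]
  obtain ⟨i', j'⟩ := k'
  obtain ⟨i, j⟩ := k
  cases j' <;> cases j <;> simp [repGen, par]

theorem tensorRep_vm (k' k : SignType × SignType) : tensorRep p (gen p .vm) k' k =
    repGen p .vm k'.1 k.1 * repGen p .Kinv k'.2 k.2 +
      (-1) ^ par k.1 * (repGen p .K k'.1 k.1 * repGen p .vm k'.2 k.2) := by
  rw [tensorRep_eq_gradedRep, coprod_gen, coprodGen, map_add, Matrix.add_apply, gradedRep_tmul,
    gradedRep_tmul, rep_gen, rep_gen, rep_gen]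
  obtain ⟨i', j'⟩ := k'
  obtain ⟨i, j⟩ := k
  cases j' <;> cases j <;> simp [repGen, par]

theorem isCoupledZero_cgZero : IsCoupledZero p (cgZero p) := by
  have hp : (p : ℂ) ≠ 0 := p.ne_zero
  intro X
  induction X using U.induction with
  | gen g =>
    have hε : counit p (gen p g) = match g with | .K => 1 | .Kinv => 1 | .vp => 0 | .vm => 0 :=
      U.lift_gen ..
    ext ⟨i, j⟩
    rw [hε]
    cases g
    · cases i <;> cases j <;>
        simp [Matrix.mulVec, dotProduct, Fintype.sum_prod_type, tensorRep_K, repGen,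
          cgZero, Matrix.diagonal, hp]
    · cases i <;> cases j <;>
        simp [Matrix.mulVec, dotProduct, Fintype.sum_prod_type, tensorRep_Kinv, repGen,
          cgZero, Matrix.diagonal, hp]
    · cases i <;> cases j <;>
        simp [Matrix.mulVec, dotProduct, Fintype.sum_prod_type, sum_sign, tensorRep_vp, repGen,
          cgZero, Matrix.diagonal, hp, par, mul_right_comm]
    · cases i <;> cases j <;>
        simp [Matrix.mulVec, dotProduct, Fintype.sum_prod_type, sum_sign, tensorRep_vm, repGen,
          cgZero, Matrix.diagonal, hp, par]
  | scalar c => rw [tensorRep_algebraMap, AlgHom.commutes, Matrix.smul_mulVec, Matrix.one_mulVec]; rfl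
  | add X Y hX hY => rw [tensorRep_add, Matrix.add_mulVec, hX, hY, map_add, add_smul]
  | mul X Y hX hY =>
    rw [tensorRep_mul, ← Matrix.mulVec_mulVec, hY, Matrix.mulVec_smul, hX, smul_smul, map_mul,
      mul_comm]

theorem tensorRep_K_mulVec_cgOne (M : SignType) :
    tensorRep p (gen p .K) *ᵥ cgOne p M = ∑ M', repGen p .K M' M • cgOne p M' := by
  have hp : (p : ℂ) ≠ 0 := p.ne_zero
  rw [sum_sign]
  ext ⟨i, j⟩
  cases M <;> cases i <;> cases j <;>
    simp [Matrix.mulVec, dotProduct, Fintype.sum_prod_type, tensorRep_K, repGen, cgOne,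
      Matrix.diagonal, hp]

theorem tensorRep_Kinv_mulVec_cgOne (M : SignType) :
    tensorRep p (gen p .Kinv) *ᵥ cgOne p M = ∑ M', repGen p .Kinv M' M • cgOne p M' := by
  have hp : (p : ℂ) ≠ 0 := p.ne_zero
  rw [sum_sign]
  ext ⟨i, j⟩
  cases M <;> cases i <;> cases j <;>
    simp [Matrix.mulVec, dotProduct, Fintype.sum_prod_type, tensorRep_Kinv, repGen, cgOne,
      Matrix.diagonal, hp]

theorem tensorRep_vp_mulVec_cgOne (M : SignType) :
    tensorRep p (gen p .vp) *ᵥ cgOne p M = ∑ M', repGen p .vp M' M • cgOne p M' := by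
  have hp : (p : ℂ) ≠ 0 := p.ne_zero
  rw [sum_sign]
  ext ⟨i, j⟩
  cases M <;> cases i <;> cases j <;>
    simp [Matrix.mulVec, dotProduct, Fintype.sum_prod_type, sum_sign, tensorRep_vp, repGen, cgOne,
      Matrix.diagonal, hp, par, mul_right_comm]
  all_goals ring

theorem tensorRep_vm_mulVec_cgOne (M : SignType) :
    tensorRep p (gen p .vm) *ᵥ cgOne p M = ∑ M', repGen p .vm M' M • cgOne p M' := by
  have hp : (p : ℂ) ≠ 0 := p.ne_zero
  rw [sum_sign]
  ext ⟨i, j⟩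
  cases M <;> cases i <;> cases j <;>
    simp [Matrix.mulVec, dotProduct, Fintype.sum_prod_type, sum_sign, tensorRep_vm, repGen, cgOne,
      Matrix.diagonal, hp, par]

theorem isCoupledOne_cgOne : IsCoupledOne p (cgOne p) := by
  intro X
  induction X using U.induction with
  | gen g =>
    intro M
    rw [rep_gen]
    cases g
    exacts [tensorRep_K_mulVec_cgOne p M, tensorRep_Kinv_mulVec_cgOne p M,
      tensorRep_vp_mulVec_cgOne p M, tensorRep_vm_mulVec_cgOne p M]
  | scalar c =>
    intro M
    rw [tensorRep_algebraMap, AlgHom.commutes, Matrix.smul_mulVec, Matrix.one_mulVec]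
    simp [Matrix.algebraMap_matrix_apply]
  | add X Y hX hY =>
    intro M
    rw [tensorRep_add, Matrix.add_mulVec, hX, hY, ← Finset.sum_add_distrib]
    simp only [map_add, Matrix.add_apply, add_smul]
  | mul X Y hX hY =>
    intro M
    rw [tensorRep_mul, ← Matrix.mulVec_mulVec, hY, Matrix.mulVec_sum]
    simp only [Matrix.mulVec_smul, hX, map_mul, Matrix.mul_apply, Finset.sum_smul, Finset.smul_sum,
      smul_smul]
    rw [Finset.sum_comm]
    simp only [mul_comm]

theorem tensorRep_K_mulVec (C : SignType × SignType → ℂ) (i j : SignType) :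
    (tensorRep p (gen p .K) *ᵥ C) (i, j) = (p : ℂ) ^ (i : ℤ) * (p : ℂ) ^ (j : ℤ) * C (i, j) := by
  simp [Matrix.mulVec, dotProduct, Fintype.sum_prod_type, tensorRep_K, repGen, Matrix.diagonal]

variable {p}

/-- Different integral weights have different `K`-eigenvalues, as `p` is not a root of unity. -/
theorem eq_zero_of_zpow_mul_eq (hp : ∀ n : ℕ, 0 < n → p ^ n ≠ 1) {a b : ℤ} (hab : a ≠ b) {c : ℂ}
    (h : (p : ℂ) ^ a * c = (p : ℂ) ^ b * c) : c = 0 := by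
  refine (mul_eq_mul_right_iff.1 h).resolve_left fun h => ?_
  rw [← Units.val_zpow_eq_zpow_val, ← Units.val_zpow_eq_zpow_val, Units.val_inj] at h
  refine hp (a - b).natAbs (Int.natAbs_pos.2 (sub_ne_zero.2 hab)) ?_
  rw [pow_natAbs_eq_one, zpow_sub, h, mul_inv_cancel]

/-- `K` leaves only the three entries of weight zero, and v₋ w = 0, read off at its two entries of
weight -1, expresses the outer ones through the middle one. -/
theorem isCoupledZero_iff (hp : ∀ n : ℕ, 0 < n → p ^ n ≠ 1) (C : SignType × SignType → ℂ) :
    IsCoupledZero p C ↔ ∃ c : ℂ, C = c • cgZero p := by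
  have h0 : (p : ℂ) ≠ 0 := p.ne_zero
  constructor
  · intro h
    have hw : ∀ i j : SignType, (i : ℤ) + j ≠ 0 → C (i, j) = 0 := by
      intro i j hij
      have hε : counit p (gen p .K) = 1 := U.lift_gen ..
      refine eq_zero_of_zpow_mul_eq hp hij ?_
      rw [zpow_add₀ h0, ← tensorRep_K_mulVec, h, hε, one_smul, zpow_zero, one_mul]
    have hv : ∀ i j : SignType, (tensorRep p (gen p .vm) *ᵥ C) (i, j) = 0 := by
      intro i j
      have hε : counit p (gen p .vm) = 0 := U.lift_gen ..
      rw [h, hε, zero_smul, Pi.zero_apply]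
    have hv1 := hv (-1) 0
    have hv2 := hv 0 (-1)
    simp [Matrix.mulVec, dotProduct, Fintype.sum_prod_type, sum_sign, tensorRep_vm, repGen,
      Matrix.diagonal, par] at hv1 hv2
    have e1 : C (-1, 1) = C (0, 0) * p := by
      field_simp at hv1
      linear_combination hv1
    have e2 : C (1, -1) = C (0, 0) * -(p : ℂ)⁻¹ := by
      field_simp
      linear_combination hv2
    refine ⟨C (0, 0), ?_⟩
    ext ⟨i, j⟩
    cases i <;> cases j <;> try (rw [hw _ _ (by decide)]; simp [cgZero])
    · simp [cgZero]
    · exact e1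
    · exact e2
  · rintro ⟨c, rfl⟩ X
    rw [Matrix.mulVec_smul, isCoupledZero_cgZero, smul_comm]

/-- A highest weight argument: w_1 has weight 1, so only two entries, and v₊ w_1 = 0 fixes their
ratio. Then w_0 = v₋ w_1 and w_{-1} = -v₋ w_0 carry the same factor. -/
theorem isCoupledOne_iff (hp : ∀ n : ℕ, 0 < n → p ^ n ≠ 1)
    (C : SignType → SignType × SignType → ℂ) :
    IsCoupledOne p C ↔ ∃ c : ℂ, C = c • cgOne p := by
  have h0 : (p : ℂ) ≠ 0 := p.ne_zero
  constructor
  · intro h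
    have hw : ∀ i j : SignType, (i : ℤ) + j ≠ 1 → C 1 (i, j) = 0 := by
      intro i j hij
      refine eq_zero_of_zpow_mul_eq hp hij ?_
      rw [zpow_add₀ h0, ← tensorRep_K_mulVec, h, rep_gen]
      simp [repGen, sum_sign]
    have hv := congrFun (h (gen p .vp) 1) (1, 1)
    rw [rep_gen] at hv
    simp [Matrix.mulVec, dotProduct, Fintype.sum_prod_type, sum_sign, tensorRep_vp, repGen,
      Matrix.diagonal, par] at hv
    -- κ must be cancelled from v₊ w_1 = 0; its numerator and denominator are nonzero because p⁴ ≠ 1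
    -- and p¹⁶ ≠ 1.
    have hκ : ((p : ℂ) ^ 2 - ((p : ℂ) ^ 2)⁻¹) / ((p : ℂ) ^ 8 - ((p : ℂ) ^ 8)⁻¹) ≠ 0 := by
      have h4 := pow_ne_one_of_forall hp (n := 4) (by norm_num)
      have h16 := pow_ne_one_of_forall hp (n := 16) (by norm_num)
      refine div_ne_zero (fun h => h4 ?_) fun h => h16 ?_ <;>
      · field_simp at h
        linear_combination h
    generalize ((p : ℂ) ^ 2 - ((p : ℂ) ^ 2)⁻¹) / ((p : ℂ) ^ 8 - ((p : ℂ) ^ 8)⁻¹) = κ at hv hκ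
    have e : C 1 (0, 1) = p * C 1 (1, 0) * -(p : ℂ) := by
      field_simp at hv
      refine mul_left_cancel₀ hκ ?_
      linear_combination -hv
    -- The factor is normalised by the entry of `cgOne p 1` at z_1 z_0, which is p⁻¹.
    have h1 : C 1 = (p * C 1 (1, 0)) • cgOne p 1 := by
      ext ⟨i, j⟩
      change C .pos _ = (p * C 1 (1, 0)) * cgOne p .pos _
      cases i <;> cases j <;> try (refine (hw _ _ (by decide)).trans ?_; simp [cgOne])
      · exact e
      · change C 1 (1, 0) = (p * C 1 (1, 0)) * (p : ℂ)⁻¹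
        field_simp
    have hm : ∀ {C : SignType → SignType × SignType → ℂ}, IsCoupledOne p C →
        tensorRep p (gen p .vm) *ᵥ C 1 = C 0 ∧ tensorRep p (gen p .vm) *ᵥ C 0 = -C (-1) := by
      intro C h
      rw [h, h, rep_gen]
      simp [repGen, sum_sign]
    have h2 := hm h
    have h3 := hm (isCoupledOne_cgOne p)
    refine ⟨p * C 1 (1, 0), funext ?_⟩
    have h4 : C 0 = (p * C 1 (1, 0)) • cgOne p 0 := by
      rw [← h2.1, ← h3.1, ← Matrix.mulVec_smul, ← h1]
    have h5 : C (-1) = (p * C 1 (1, 0)) • cgOne p (-1) := by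
      rw [← neg_inj, ← h2.2, ← smul_neg, ← h3.2, ← Matrix.mulVec_smul, ← h4]
    rw [forall_signType]
    exact ⟨h1, h4, h5⟩
  · rintro ⟨c, rfl⟩ X M
    simp only [Pi.smul_apply, Matrix.mulVec_smul, isCoupledOne_cgOne p X M, Finset.smul_sum,
      smul_comm c]

end CoupledBases

/-! ### Products of matrix entries as functionals, and covariance of the composites -/

section Covariance

/-- The contraction of the second tensor factor with the counit. -/
noncomputable def idCounit : part (U p) ᵍ⊗[ℂ] part (U p) →ₐ[ℂ] U p :=
  GradedTensorProduct.lift (part (U p)) (part (U p)) (AlgHom.id ℂ (U p))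
    ((Algebra.ofId ℂ (U p)).comp (counit p)) (by
      rintro i j ⟨a, ha⟩ ⟨b, hb⟩
      -- The counit vanishes on odd elements, so the sign in the graded commutation condition never
      -- matters.
      have h : j = 0 ∨ counit p b = 0 := by
        have hj : ∀ j : ZMod 2, j = 0 ∨ j = 1 := by decide
        obtain rfl | rfl := hj j
        · exact .inl rfl
        · refine .inr ?_
          have := counit_parity p b
          rw [mem_part_one.1 hb, map_neg] at this
          exact self_eq_neg.1 this.symm
      rcases h with rfl | h
      · simp [Algebra.ofId_apply, Algebra.commutes]
      · simp only [AlgHom.comp_apply, h, map_zero, mul_zero, zero_mul]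
        exact (smul_zero _).symm)

theorem idCounit_coprod (X : U p) : idCounit p (coprod p X) = X := by
  have h : (idCounit p).comp (coprod p) = AlgHom.id ℂ (U p) := by
    apply U.hom_ext
    intro g
    have ht : ∀ x y : U p, idCounit p (x ᵍ⊗ₜ[ℂ] y) = x * algebraMap ℂ _ (counit p y) :=
      fun x y => lift_tmul _ _ _ _ _ x y
    have hε : ∀ g, counit p (gen p g) = match g with | .K => 1 | .Kinv => 1 | .vp => 0 | .vm => 0 :=
      fun g => U.lift_gen ..
    rw [AlgHom.comp_apply, coprod_gen]
    cases g <;> simp [coprodGen, ht, hε]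
  exact DFunLike.congr_fun h X

/-- The counit law for the second factor; the parity twist disappears because the counit is even. It
identifies the functional of a single generator with `matrixCoeff`. -/
theorem conv_counit (n : ℕ) (f : U p →ₗ[ℂ] ℂ) : conv p n f (counit p).toLinearMap = f := by
  ext X
  conv_rhs => rw [← idCounit_coprod p X]
  rw [conv, LinearMap.comp_apply, LinearMap.comp_apply, LinearMap.comp_apply,
    AlgHom.toLinearMap_apply]
  generalize coprod p X = Z
  induction Z using graded_induction with
  | zero => simp
  | add x y hx hy => simp only [map_add, hx, hy]
  | tmul x y =>
    have hε : counit p (((parity : U p →ₐ[ℂ] U p) ^ n) y) = counit p y := by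
      induction n with
      | zero => rfl
      | succ n ih => rw [pow_succ', AlgHom.mul_apply, counit_parity, ih]
    have ht : idCounit p (x ᵍ⊗ₜ[ℂ] y) = x * algebraMap ℂ _ (counit p y) :=
      lift_tmul _ _ _ _ _ x y
    rw [ht, ← Algebra.commutes, ← Algebra.smul_def, map_smul, smul_eq_mul, mul_comm]
    exact congrArg (f x * ·) hε

theorem pairing_ι (t : SignType × SignType) :
    pairing p (FreeAlgebra.ι ℂ t) = matrixCoeff p t.1 t.2 := by
  rw [pairing, FreeAlgebra.lift_ι_apply]
  exact conv_counit p _ _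

theorem matrixCoeff_apply (i j : SignType) (X : U p) :
    matrixCoeff p i j X = (-1) ^ (par i * (par i + par j)) * rep p X i j := by
  rw [← rep_parity_pow]
  rfl

/-- Four signs meet: one in the definition of each entry, one from the graded product of
functionals, one from the action on V ⊗ V. The last two and the sign of the second entry combine,
modulo 2, to the second summand of the exponent. -/
theorem pairing_ι_mul_ι (s t : SignType × SignType) (X : U p) :
    pairing p (FreeAlgebra.ι ℂ s * FreeAlgebra.ι ℂ t) X =
      (-1) ^ (par s.1 * (par s.1 + par s.2) + (par s.1 + par t.1) * (par t.1 + par t.2)) *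
        tensorRep p X (s.1, t.1) (s.2, t.2) := by
  have h : pairing p (FreeAlgebra.ι ℂ s * FreeAlgebra.ι ℂ t) X =
      conv p (par s.1 + par s.2) (matrixCoeff p s.1 s.2) (matrixCoeff p t.1 t.2) X := by
    rw [← pairing_ι p t, pairing, map_mul, Module.End.mul_apply, FreeAlgebra.lift_ι_apply]
    rfl
  rw [h, tensorRep_eq_gradedRep, conv, LinearMap.comp_apply, LinearMap.comp_apply,
    LinearMap.comp_apply, AlgHom.toLinearMap_apply]
  generalize coprod p X = Z
  induction Z using graded_induction with
  | zero => simp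
  | add x y hx hy => simp only [map_add, hx, hy, Matrix.add_apply, mul_add]
  | tmul x y =>
    rw [gradedRep_tmul]
    have e : (-1 : ℂ) ^ par s.1 * (-1) ^ par s.1 = 1 := by rw [← mul_pow]; simp
    have h' : ∀ f g : U p →ₗ[ℂ] ℂ, LinearMap.mul' ℂ ℂ (TensorProduct.map f g
        ((GradedTensorProduct.of ℂ (part (U p)) (part (U p))).symm.toLinearMap
          (x ᵍ⊗ₜ[ℂ] y))) = f x * g y := fun f g => rfl
    rw [h', LinearMap.comp_apply, AlgHom.toLinearMap_apply, matrixCoeff_apply, matrixCoeff_apply,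
      rep_parity_pow]
    simp only [pow_add, pow_mul, add_mul, mul_add]
    ring

theorem parity_T (i j : SignType) : parity (A.T p i j) = (-1 : ℂ) ^ (par i + par j) • A.T p i j := by
  rw [A.T]
  refine (quotientParity_mk parT (ARel p) _ _).trans ?_
  rw [freeParity_ι, map_smul, parT]

theorem pairing_smul (c : ℂ) (f : FreeAlgebra ℂ (SignType × SignType)) (X : U p) :
    pairing p (c • f) X = c * pairing p f X := by
  simp [pairing]

theorem pairing_sum {ι : Type*} (s : Finset ι) (f : ι → FreeAlgebra ℂ (SignType × SignType))
    (X : U p) : pairing p (∑ i ∈ s, f i) X = ∑ i ∈ s, pairing p (f i) X := by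
  simp [pairing]

theorem pairing_algebraMap (c : ℂ) (X : U p) :
    pairing p (algebraMap ℂ _ c) X = c * counit p X := by
  simp [pairing, Module.algebraMap_end_apply]

/-- A combination of the products `T_{i'i} T_{j'j}`, in terms of the action on the tensor square. -/
theorem sum_T_mul_T (C : SignType × SignType → ℂ) (k' : SignType × SignType)
    (f : FreeAlgebra ℂ (SignType × SignType))
    (h : ∀ X, pairing p f X = ∑ k, C k * ((-1) ^ ((par k'.1 + par k'.2) * (1 + par k.1 + par k.2)) *
      tensorRep p X k' k)) :
    ∑ k, C k • (-1 : ℂ) ^ ((par k'.1 + par k.1) * par k'.2) •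
      (A.T p k'.1 k.1 * A.T p k'.2 k.2) = RingQuot.mkAlgHom ℂ (ARel p) f := by
  simp only [A.T, ← map_mul, ← map_smul, ← map_sum]
  refine RingQuot.mkAlgHom_rel ℂ fun X => ?_
  rw [h, pairing_sum]
  refine Finset.sum_congr rfl fun k _ => ?_
  rw [pairing_smul, pairing_smul, pairing_ι_mul_ι, ← mul_assoc ((-1 : ℂ) ^ _), ← pow_add]
  congr 2
  -- Only the parities of the exponents count, which leaves a propositional tautology.
  apply neg_one_pow_congr
  simp only [Nat.even_add, Nat.even_mul, Nat.not_even_one]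
  tauto

/-- The left side is the coefficient of z_{k'.1} z_{k'.2} in φ(E^0); the identity is the invariance
of `cgZero` paired with each element of the quantum superalgebra. -/
theorem sum_cgZero_T_mul_T (k' : SignType × SignType) :
    ∑ k, cgZero p k • (-1 : ℂ) ^ ((par k'.1 + par k.1) * par k'.2) •
      (A.T p k'.1 k.1 * A.T p k'.2 k.2) = cgZero p k' • (1 : A p) := by
  rw [sum_T_mul_T p _ _ (algebraMap ℂ _ (cgZero p k')), AlgHom.commutes,
    Algebra.algebraMap_eq_smul_one]
  intro X
  have h := congrFun (isCoupledZero_cgZero p X) k'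
  rw [Pi.smul_apply, smul_eq_mul, Matrix.mulVec, dotProduct] at h
  -- `cgZero` lives on pairs of even total parity, so the sign depends on `k'` alone and leaves the
  -- sum.
  have h1 : ∀ k, cgZero p k * ((-1) ^ ((par k'.1 + par k'.2) * (1 + par k.1 + par k.2)) *
      tensorRep p X k' k) =
      (-1) ^ (par k'.1 + par k'.2) * (tensorRep p X k' k * cgZero p k) := by
    rintro ⟨i, j⟩
    generalize tensorRep p X k' (i, j) = x
    generalize par k'.1 + par k'.2 = n
    have e : (-1 : ℂ) ^ (n * 3) = (-1) ^ n := by rw [pow_mul']; norm_num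
    cases i <;> cases j <;> simp [cgZero, par, e] <;> ring
  have h2 : (-1) ^ (par k'.1 + par k'.2) * cgZero p k' = cgZero p k' := by
    obtain ⟨i, j⟩ := k'
    cases i <;> cases j <;> simp [cgZero, par]
  rw [pairing_algebraMap, Finset.sum_congr rfl fun k _ => h1 k, ← Finset.mul_sum, h, mul_left_comm,
    h2, mul_comm]

/-- The same contraction for L = 1. E^1_M has parity opposite to z_M, and this shift produces the
sign that distinguishes `A.T'` from `A.T`. -/
theorem sum_cgOne_T_mul_T (M : SignType) (k' : SignType × SignType) :
    ∑ k, cgOne p M k • (-1 : ℂ) ^ ((par k'.1 + par k.1) * par k'.2) •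
      (A.T p k'.1 k.1 * A.T p k'.2 k.2) = ∑ M', cgOne p M' k' • A.T' p M' M := by
  rw [sum_T_mul_T p _ _ (∑ M', cgOne p M' k' •
    (-1 : ℂ) ^ (par M' + par M) • FreeAlgebra.ι ℂ (M', M))]
  · simp only [map_sum, map_smul]
    rfl
  intro X
  have h := congrFun (isCoupledOne_cgOne p X M) k'
  rw [Finset.sum_apply, Matrix.mulVec, dotProduct] at h
  -- On the support of `cgOne p M` the exponent factor 1 + par k.1 + par k.2 has the parity of `par
  -- M`.
  have h1 : ∀ k, cgOne p M k * ((-1) ^ ((par k'.1 + par k'.2) * (1 + par k.1 + par k.2)) *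
      tensorRep p X k' k) =
      (-1) ^ ((par k'.1 + par k'.2) * par M) * (tensorRep p X k' k * cgOne p M k) := by
    rintro ⟨i, j⟩
    generalize tensorRep p X k' (i, j) = x
    generalize par k'.1 + par k'.2 = n
    have e : (-1 : ℂ) ^ (n * 3) = (-1) ^ n := by rw [pow_mul']; norm_num
    have e' : (-1 : ℂ) ^ (n * 2) = 1 := by rw [pow_mul']; norm_num
    cases M <;> cases i <;> cases j <;> simp [cgOne, par, e, e'] <;> ring
  rw [pairing_sum, Finset.sum_congr rfl fun k _ => h1 k, ← Finset.mul_sum, h, Finset.mul_sum]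
  refine Finset.sum_congr rfl fun M' _ => ?_
  rw [pairing_smul, pairing_smul, pairing_ι, matrixCoeff_apply, Pi.smul_apply, smul_eq_mul]
  obtain ⟨i, j⟩ := k'
  generalize rep p X M' M = x
  cases M' <;> cases i <;> cases j <;> cases M <;> simp [cgOne, par, mul_comm]

variable {p} {B : Type*} [Ring B] [Algebra ℂ B] [SuperAlgebra B] {z : SignType → B}

/-- Stated for coordinates of the right parity in any superalgebra, so that it serves both the free
algebra and the quantum superspace. The sign comes from moving the second coordinate past the first
matrix entry. -/
theorem composite_coaction (hz : ∀ m, parity (z m) = (-1 : ℂ) ^ par m • z m)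
    (C : SignType × SignType → ℂ) :
    composite C (fun m => ∑ m', z m' ᵍ⊗ₜ[ℂ] A.T p m' m : SignType → part B ᵍ⊗[ℂ] part (A p)) =
      ∑ k' : SignType × SignType, (z k'.1 * z k'.2) ᵍ⊗ₜ[ℂ]
        (∑ k, C k • (-1 : ℂ) ^ ((par k'.1 + par k.1) * par k'.2) •
          (A.T p k'.1 k.1 * A.T p k'.2 k.2)) := by
  have h : ∀ k : SignType × SignType,
      ((∑ m', z m' ᵍ⊗ₜ[ℂ] A.T p m' k.1) * ∑ m', z m' ᵍ⊗ₜ[ℂ] A.T p m' k.2 :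
        part B ᵍ⊗[ℂ] part (A p)) =
      ∑ k' : SignType × SignType, (-1 : ℂ) ^ ((par k'.1 + par k.1) * par k'.2) •
        (z k'.1 * z k'.2) ᵍ⊗ₜ[ℂ] (A.T p k'.1 k.1 * A.T p k'.2 k.2) := by
    intro k
    rw [Finset.sum_mul_sum, Fintype.sum_prod_type]
    refine Finset.sum_congr rfl fun i _ => Finset.sum_congr rfl fun j _ => ?_
    exact tmul_mul_tmul_of_parity _ _ (parity_T p _ _) (hz _)
  simp only [composite, h, Finset.smul_sum]
  rw [Finset.sum_comm]
  simp only [tmul, TensorProduct.tmul_sum, TensorProduct.tmul_smul, map_sum, map_smul]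

theorem composite_cgZero_coaction (hz : ∀ m, parity (z m) = (-1 : ℂ) ^ par m • z m) :
    composite (cgZero p)
      (fun m => ∑ m', z m' ᵍ⊗ₜ[ℂ] A.T p m' m : SignType → part B ᵍ⊗[ℂ] part (A p)) =
      composite (cgZero p) z ᵍ⊗ₜ[ℂ] 1 := by
  rw [composite_coaction hz]
  simp only [sum_cgZero_T_mul_T, composite, tmul, TensorProduct.tmul_smul, TensorProduct.sum_tmul,
    ← TensorProduct.smul_tmul', map_sum, map_smul]

theorem composite_cgOne_coaction (hz : ∀ m, parity (z m) = (-1 : ℂ) ^ par m • z m) (M : SignType) :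
    composite (cgOne p M)
      (fun m => ∑ m', z m' ᵍ⊗ₜ[ℂ] A.T p m' m : SignType → part B ᵍ⊗[ℂ] part (A p)) =
      ∑ M', composite (cgOne p M') z ᵍ⊗ₜ[ℂ] A.T' p M' M := by
  rw [composite_coaction hz]
  simp only [sum_cgOne_T_mul_T, composite, tmul, TensorProduct.tmul_smul, TensorProduct.sum_tmul,
    TensorProduct.tmul_sum, ← TensorProduct.smul_tmul', map_sum, map_smul]
  exact Finset.sum_comm

theorem map_composite {R S : Type*} [Ring R] [Algebra ℂ R] [Ring S] [Algebra ℂ S] (f : R →ₐ[ℂ] S)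
    (C : SignType × SignType → ℂ) (z : SignType → R) :
    f (composite C z) = composite C fun m => f (z m) := by
  simp [composite]

theorem freeCoaction_composite (C : SignType × SignType → ℂ) :
    freeCoaction p (composite C (FreeAlgebra.ι ℂ)) =
      composite C fun m => ∑ m', FreeAlgebra.ι ℂ m' ᵍ⊗ₜ[ℂ] A.T p m' m := by
  rw [map_composite]
  simp [freeCoaction]

end Covariance

/-! ### The coaction on the quantum superspace -/

section SuperspaceCovariance

variable {p} {r : ℂ}

theorem Superspace.isSuperspace_z : IsSuperspace p r (Superspace.z p r) := by
  refine ⟨?_, ?_, ?_, ?_⟩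
  · simpa [Superspace.z] using RingQuot.mkAlgHom_rel ℂ (PlaneRel.z1_z0 (p := p) (r := r))
  · simpa [Superspace.z] using RingQuot.mkAlgHom_rel ℂ (PlaneRel.z0_zm (p := p) (r := r))
  · simpa [Superspace.z] using RingQuot.mkAlgHom_rel ℂ (PlaneRel.z1_zm (p := p) (r := r))
  · have h := RingQuot.mkAlgHom_rel ℂ (PlaneRel.z0_sq (p := p) (r := r))
    simp only [map_sub, map_smul, map_mul, map_pow, map_one] at h
    exact h

theorem Superspace.parity_z (m : SignType) :
    parity (Superspace.z p r m) = (-1 : ℂ) ^ par m • Superspace.z p r m := by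
  rw [Superspace.z]
  refine (quotientParity_mk par (PlaneRel p r) _ _).trans ?_
  rw [freeParity_ι, map_smul]

/-- The universal property of the quantum superspace. -/
noncomputable def Superspace.lift {B : Type*} [Ring B] [Algebra ℂ B] (z : SignType → B)
    (hz : IsSuperspace p r z) : Superspace p r →ₐ[ℂ] B :=
  RingQuot.liftAlgHom ℂ ⟨FreeAlgebra.lift ℂ z, by
    obtain ⟨h1, h2, h3, h4⟩ := hz
    intro a b h
    cases h
    · simpa using h1
    · simpa using h2
    · simpa using h3
    · simpa using h4⟩

theorem Superspace.lift_z {B : Type*} [Ring B] [Algebra ℂ B] (z : SignType → B)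
    (hz : IsSuperspace p r z) (m : SignType) :
    Superspace.lift z hz (Superspace.z p r m) = z m := by
  simp [Superspace.lift, Superspace.z]

/-- In the form E^0 = r, E^1_M = 0 the relations are visibly stable: the coaction sends E^0 to E^0 ⊗
1 and each E^1_M to a combination of the E^1_{M'}, which vanish. -/
theorem isSuperspace_coaction (hp : ∀ n : ℕ, 0 < n → p ^ n ≠ 1) :
    IsSuperspace p r (fun m => ∑ m', Superspace.z p r m' ᵍ⊗ₜ[ℂ] A.T p m' m :
      SignType → part (Superspace p r) ᵍ⊗[ℂ] part (A p)) := by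
  have h := (composite_iff_isSuperspace hp r _).2 (Superspace.isSuperspace_z (p := p) (r := r))
  rw [← composite_iff_isSuperspace hp, composite_cgZero_coaction Superspace.parity_z, h.1]
  refine ⟨rfl, fun M => ?_⟩
  rw [composite_cgOne_coaction Superspace.parity_z]
  simp [h.2, tmul]

end SuperspaceCovariance

end OSpq

open OSpq OSpq.SuperAlgebra GradedTensorProduct TensorProduct in
theorem mainTheorem3 {Λ : Type*} [Ring Λ] [Algebra ℂ Λ] [SuperAlgebra Λ]
    (hΛ : IsSupercommutative Λ) (p : ℂˣ) (hp : ∀ n : ℕ, 0 < n → p ^ n ≠ 1) (r : ℂ) (ξ : Λ)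
    (hξ : parity ξ = -ξ) :
    -- the `L = 0` and `L = 1` components of the tensor square
    (∀ C, IsCoupledZero p C ↔ ∃ c : ℂ, C = c • cgZero p) ∧
    (∀ C, IsCoupledOne p C ↔ ∃ c : ℂ, C = c • cgOne p) ∧
    -- covariance of the composites
    freeCoaction p (composite (cgZero p) (FreeAlgebra.ι ℂ)) =
      composite (cgZero p) (FreeAlgebra.ι ℂ) ᵍ⊗ₜ[ℂ] 1 ∧
    (∀ M, freeCoaction p (composite (cgOne p M) (FreeAlgebra.ι ℂ)) =
      ∑ M', composite (cgOne p M') (FreeAlgebra.ι ℂ) ᵍ⊗ₜ[ℂ] A.T' p M' M) ∧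
    -- consistency
    (Consistent p r ξ ↔ ξ = 0) ∧
    (ReorderingConsistent (relators p r ξ) ↔ ξ = 0) ∧
    (Space.HasOrderedBasis (relators p r ξ) ↔ ξ = 0) ∧
    -- the relations of the covariant algebra
    (∀ {B : Type*} [Ring B] [Algebra ℂ B] (z : SignType → B),
      (composite (cgZero p) z = algebraMap ℂ B r ∧ ∀ M, composite (cgOne p M) z = 0) ↔
        IsSuperspace p r z) ∧
    -- covariance of the algebra
    ∃ φ : Superspace p r →ₐ[ℂ] part (Superspace p r) ᵍ⊗[ℂ] part (A p),
      ∀ m, φ (Superspace.z p r m) = ∑ m', Superspace.z p r m' ᵍ⊗ₜ[ℂ] A.T p m' m := by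
  have hzero : ReorderingConsistent (relators p r ξ) → ξ = 0 :=
    eq_zero_of_reorderingConsistent hp hξ
  have hbasis : ξ = 0 → Space.HasOrderedBasis (relators p r ξ) := by
    rintro rfl
    exact Space.hasOrderedBasis_zero hp
  have hreord : ξ = 0 → ReorderingConsistent (relators p r ξ) := fun h =>
    Space.reorderingConsistent_of_hasOrderedBasis _ (hbasis h)
  refine ⟨isCoupledZero_iff hp, isCoupledOne_iff hp, ?_, fun M => ?_,
    ⟨fun h => hzero h.2, fun h => ⟨?_, hreord h⟩⟩,
    ⟨hzero, hreord⟩,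
    ⟨fun h => hzero (Space.reorderingConsistent_of_hasOrderedBasis _ h), hbasis⟩,
    fun z => composite_iff_isSuperspace hp r z,
    Superspace.lift _ (isSuperspace_coaction hp), fun m => Superspace.lift_z _ _ m⟩
  · rw [freeCoaction_composite]
    exact composite_cgZero_coaction (freeParity_ι par)
  · rw [freeCoaction_composite]
    exact composite_cgOne_coaction (freeParity_ι par) M
  · subst h
    exact radiusCommutes_zero p
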